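/- **Setting.** Let $\phi:\mathbb R\to[0,\infty]$ be a closed (lower semicontinuous) convex function with $\phi(1)=0$, whose domain $\{\phi<\infty\}$ is an interval with endpoints $a<1<b$ (possibly infinite). Assume that $\phi$ is strictly convex on $(a,b)$, essentially smooth ($\phi'(x)\to-\infty$ as $x\downarrow a$ if $a>-\infty$, and $\phi'(x)\to+\infty$ as $x\uparrow b$ if $b<\infty$), and four times continuously differentiable on $(a,b)$. For probability measures $Q,P$ put $D_\phi(Q,P)=\int\phi(dQ/dP)\,dP$ if $Q\ll P$, and $D_\phi(Q,P)=+\infty$ otherwise. Let $\{P_\alpha;\alpha\in\Theta\}$, $\Theta\subseteq\mathbb R^d$, be an identifiable family of probability measures on a measurable space $\mathcal X$ with densities $p_\alpha\ge 0$ with respect to a $\sigma$-finite measure $\lambda$. Assume that the set $\{p_\alpha>0\}$ does not depend on $\alpha\in\Theta$ (outside one $\lambda$-null set) and that, for $\lambda$-almost every $x$, $\alpha\mapsto p_\alpha(x)$ has continuous partial derivatives up to order three on the interior of $\Theta$. Let $\theta_T$ be an interior point of $\Theta$ and fix $\theta\in\Theta$. For $\alpha\in\Theta$ put $$f(\theta,\alpha,x)=\phi'\Big(\tfrac{p_\theta(x)}{p_\alpha(x)}\Big),\qquad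 g(\theta,\alpha,x)=\tfrac{p_\theta(x)}{p_\alpha(x)}\,\phi'\Big(\tfrac{p_\theta(x)}{p_\alpha(x)}\Big)-\phi\Big(\tfrac{p_\theta(x)}{p_\alpha(x)}\Big),$$ $$h(\theta,\alpha,x)=\int f(\theta,\alpha,y)\,dP_\theta(y)-g(\theta,\alpha,x).$$ Assume that $f(\theta,\cdot,\cdot)$ is well defined and finite, i.e. for $P_\theta$-almost every $x$ one has $p_\theta(x)/p_\alpha(x)\in(a,b)$ for all $\alpha\in\Theta$, and that $\int|f(\theta,\alpha,x)|\,dP_\theta(x)<\infty$ for every $\alpha\in\Theta$. Let $X_1,X_2,\dots$ be i.i.d. with law $P_{\theta_T}$, let $P_n$ be the empirical measure of $X_1,\dots,X_n$, write $Pu=\int u\,dP$, and let $$\widehat D_\phi(\theta,\theta_T)=\sup_{\alpha\in\Theta}P_nh(\theta,\alpha),$$ with $\widehat\alpha_\phi(\theta)$ any maximizer over $\Theta$ of $\alpha\mapsto P_nh(\theta,\alpha)$ (both assumed to be measurable functions of the outcome). Let $\partial$ denote partial derivatives in $\alpha$. **Assumptions.** - (A.0) $\widehat\alpha_\phi(\theta)$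 exists (it is a maximizer over $\Theta$ with probability tending to one) and converges in probability to $\theta_T$. - (A.1) There is a neighbourhood $N\subseteq\Theta$ of $\theta_T$ on which all first and second order partial derivatives of $\alpha\mapsto f(\theta,\alpha,x)p_\theta(x)$ are dominated by $\lambda$-integrable functions of $x$, and on which, for $P_{\theta_T}$-almost every $x$, all third order partial derivatives of $\alpha\mapsto h(\theta,\alpha,x)$ exist and are dominated by $P_{\theta_T}$-integrable functions of $x$. - (A.2) $P_{\theta_T}\|\partial h(\theta,\theta_T)\|^2<\infty$, $P_{\theta_T}\|\partial^2h(\theta,\theta_T)\|<\infty$, and $S:=-P_{\theta_T}\partial^2h(\theta,\theta_T)$ is nonsingular. - (A.3) $P_{\theta_T}h(\theta,\theta_T)^2<\infty$. **Theorem.** Assume (A.0), (A.1) and (A.2). Put $M=P_{\theta_T}\big[\partial h(\theta,\theta_T)\,\partial h(\theta,\theta_T)^T\big]$ and $V=S^{-1}MS^{-1}$. (a) $V$ is positive semidefinite and $\sqrt n\,(\widehat\alpha_\phi(\theta)-\theta_T)$ converges in distribution to $N(0,V)$. If $\theta=\theta_T$, then the Fisher information matrix $I_{\theta_T}=\int \frac{(\partial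 p_{\theta_T})(\partial p_{\theta_T})^T}{p_{\theta_T}}\,d\lambda$ (where $0/0=0$) is finite and invertible, and $V=I_{\theta_T}^{-1}$. (b) If $\theta=\theta_T$, then $\frac{2n}{\phi''(1)}\widehat D_\phi(\theta,\theta_T)$ converges in distribution to a $\chi^2$ variable with $d$ degrees of freedom. (c) If in addition (A.3) holds and $\theta\ne\theta_T$, then $D_\phi(P_\theta,P_{\theta_T})$ is finite and $\sqrt n\,\big(\widehat D_\phi(\theta,\theta_T)-D_\phi(P_\theta,P_{\theta_T})\big)$ converges in distribution to $N(0,\sigma_\phi^2)$, where $\sigma_\phi^2=P_{\theta_T}h(\theta,\theta_T)^2-\big(P_{\theta_T}h(\theta,\theta_T)\big)^2\ge0$. -/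

import Mathlib

open MeasureTheory ProbabilityTheory Filter Topology
open scoped ENNReal Matrix

noncomputable section

namespace DualDivergence

/-! ### Convex functions and divergences -/

/-- The effective domain of a function with values in `[0, ∞]`. -/
def dom (φ : ℝ → ℝ≥0∞) : Set ℝ := {x | φ x < ⊤}

/-- The real values of `φ`; only meaningful on `dom φ`. -/
def re (φ : ℝ → ℝ≥0∞) (x : ℝ) : ℝ := (φ x).toReal

/-- The closed convex functions `φ : ℝ → [0, ∞]` with `φ 1 = 0` whose domain is an interval with
endpoints `a < 1 < b`, which are strictly convex and essentially smooth, and which have continuous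
derivatives up to order four in the interior `(a, b)` of the domain.
Closedness of a convex function is its lower semicontinuity. -/
structure IsDivergenceFunction (φ : ℝ → ℝ≥0∞) : Prop where
  map_one : φ 1 = 0
  one_mem : (1 : ℝ) ∈ interior (dom φ)
  convex : ConvexOn ℝ (dom φ) (re φ)
  closed : LowerSemicontinuous φ
  strictConvex : StrictConvexOn ℝ (interior (dom φ)) (re φ)
  tendsto_left : ∀ a : ℝ, IsGLB (dom φ) a → Tendsto (deriv (re φ)) (𝓝[>] a) atBot
  tendsto_right : ∀ b : ℝ, IsLUB (dom φ) b → Tendsto (deriv (re φ)) (𝓝[<] b) atTop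
  contDiff : ContDiffOn ℝ 4 (re φ) (interior (dom φ))

open Classical in
/-- The `φ`-divergence `D_φ(Q, P) = ∫ φ(dQ/dP) dP`, equal to `∞` if `Q` is not absolutely
continuous with respect to `P`. -/
def divergence {𝒳 : Type*} [MeasurableSpace 𝒳] (φ : ℝ → ℝ≥0∞) (Q P : Measure 𝒳) : ℝ≥0∞ :=
  if Q ≪ P then ∫⁻ x, φ (Q.rnDeriv P x).toReal ∂P else ⊤

/-! ### The parametric model -/

/-- The measure `P_α` with density `p_α` with respect to `lam`. -/
def modelMeasure {𝒳 : Type*} [MeasurableSpace 𝒳] {d : ℕ} (lam : Measure 𝒳)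
    (p : EuclideanSpace ℝ (Fin d) → 𝒳 → ℝ) (α : EuclideanSpace ℝ (Fin d)) : Measure 𝒳 :=
  lam.withDensity fun x => ENNReal.ofReal (p α x)

/-- An identifiable dominated family of probability measures `P_α`, `α ∈ Θ`, with a support
`{x | 0 < p_α x}` that does not depend on `α` (outside of one `lam`-null set), the densities
having, for `lam`-almost every `x`, continuous partial derivatives up to order three in `α`. -/
structure IsRegularModel {𝒳 : Type*} [MeasurableSpace 𝒳] {d : ℕ} (lam : Measure 𝒳)
    (Θ : Set (EuclideanSpace ℝ (Fin d))) (p : EuclideanSpace ℝ (Fin d) → 𝒳 → ℝ) : Prop where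
  measurable : ∀ α ∈ Θ, Measurable (p α)
  nonneg : ∀ α ∈ Θ, ∀ x, 0 ≤ p α x
  isProbabilityMeasure : ∀ α ∈ Θ, IsProbabilityMeasure (modelMeasure lam p α)
  identifiable : Set.InjOn (modelMeasure lam p) Θ
  support_eq : ∀ᵐ x ∂lam, ∀ α ∈ Θ, ∀ β ∈ Θ, (0 < p α x ↔ 0 < p β x)
  contDiff : ∀ᵐ x ∂lam, ContDiffOn ℝ 3 (fun α => p α x) (interior Θ)

/-- The partial derivative `∂u/∂α_i` at `α`. -/
def pderiv {d : ℕ} (i : Fin d) (u : EuclideanSpace ℝ (Fin d) → ℝ)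
    (α : EuclideanSpace ℝ (Fin d)) : ℝ :=
  lineDeriv ℝ u α (EuclideanSpace.single i 1)

/-- The Fisher information matrix at `α`. -/
def fisher {𝒳 : Type*} [MeasurableSpace 𝒳] {d : ℕ} (lam : Measure 𝒳)
    (p : EuclideanSpace ℝ (Fin d) → 𝒳 → ℝ) (α : EuclideanSpace ℝ (Fin d)) :
    Matrix (Fin d) (Fin d) ℝ :=
  Matrix.of fun i j =>
    ∫ x, pderiv i (fun a => p a x) α * pderiv j (fun a => p a x) α / p α x ∂lam

/-! ### The functions `f`, `g`, `h` of the dual representation -/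

/-- `f(θ, α, x) = φ'(p_θ(x) / p_α(x))`. -/
def f {𝒳 : Type*} {d : ℕ} (φ : ℝ → ℝ≥0∞) (p : EuclideanSpace ℝ (Fin d) → 𝒳 → ℝ)
    (θ α : EuclideanSpace ℝ (Fin d)) (x : 𝒳) : ℝ :=
  deriv (re φ) (p θ x / p α x)

/-- `g(θ, α, x) = (p_θ(x) / p_α(x)) φ'(p_θ(x) / p_α(x)) - φ(p_θ(x) / p_α(x))`. -/
def g {𝒳 : Type*} {d : ℕ} (φ : ℝ → ℝ≥0∞) (p : EuclideanSpace ℝ (Fin d) → 𝒳 → ℝ)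
    (θ α : EuclideanSpace ℝ (Fin d)) (x : 𝒳) : ℝ :=
  p θ x / p α x * deriv (re φ) (p θ x / p α x) - re φ (p θ x / p α x)

/-- `h(θ, α, x) = P_θ f(θ, α) - g(θ, α, x)`. -/
def h {𝒳 : Type*} [MeasurableSpace 𝒳] {d : ℕ} (φ : ℝ → ℝ≥0∞) (lam : Measure 𝒳)
    (p : EuclideanSpace ℝ (Fin d) → 𝒳 → ℝ) (θ α : EuclideanSpace ℝ (Fin d)) (x : 𝒳) : ℝ :=
  ∫ y, f φ p θ α y ∂(modelMeasure lam p θ) - g φ p θ α x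

/-- For fixed `θ`: the functions `f(θ, α, ·)`, `α ∈ Θ`, are well defined and finite (the ratio
`p_θ / p_α` lies in the interior of the domain of `φ`, where `φ'` is defined and finite, on the
common support up to one null set), and they are integrable with respect to `P_θ`. -/
def DualIntegrable {𝒳 : Type*} [MeasurableSpace 𝒳] {d : ℕ} (φ : ℝ → ℝ≥0∞) (lam : Measure 𝒳)
    (Θ : Set (EuclideanSpace ℝ (Fin d))) (p : EuclideanSpace ℝ (Fin d) → 𝒳 → ℝ)
    (θ : EuclideanSpace ℝ (Fin d)) : Prop :=
  (∀ᵐ x ∂(modelMeasure lam p θ), ∀ α ∈ Θ, p θ x / p α x ∈ interior (dom φ)) ∧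
  ∀ α ∈ Θ, Integrable (f φ p θ α) (modelMeasure lam p θ)

/-! ### The estimates -/

/-- `P_n u`, the integral of `u` with respect to the empirical measure of `X_0, …, X_{n-1}`. -/
def empMean {𝒳 Ω : Type*} (X : ℕ → Ω → 𝒳) (n : ℕ) (u : 𝒳 → ℝ) (ω : Ω) : ℝ :=
  (n : ℝ)⁻¹ * ∑ i ∈ Finset.range n, u (X i ω)

/-- The estimate `sup_{α ∈ Θ} P_n h(θ, α)` of the divergence `D_φ(P_θ, P_{θ_T})`.
It is a real supremum, hence correct whenever the supremum is finite. -/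
def divEstimate {𝒳 Ω : Type*} [MeasurableSpace 𝒳] {d : ℕ} (φ : ℝ → ℝ≥0∞) (lam : Measure 𝒳)
    (Θ : Set (EuclideanSpace ℝ (Fin d))) (p : EuclideanSpace ℝ (Fin d) → 𝒳 → ℝ)
    (X : ℕ → Ω → 𝒳) (θ : EuclideanSpace ℝ (Fin d)) (n : ℕ) (ω : Ω) : ℝ :=
  sSup ((fun α => empMean X n (h φ lam p θ α) ω) '' Θ)

/-- `a` is a maximizer over `Θ` of `α ↦ P_n h(θ, α)`, at the outcome `ω`. -/
def IsDualEstimate {𝒳 Ω : Type*} [MeasurableSpace 𝒳] {d : ℕ} (φ : ℝ → ℝ≥0∞) (lam : Measure 𝒳)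
    (Θ : Set (EuclideanSpace ℝ (Fin d))) (p : EuclideanSpace ℝ (Fin d) → 𝒳 → ℝ)
    (X : ℕ → Ω → 𝒳) (θ : EuclideanSpace ℝ (Fin d)) (n : ℕ) (ω : Ω)
    (a : EuclideanSpace ℝ (Fin d)) : Prop :=
  a ∈ Θ ∧ IsMaxOn (fun α => empMean X n (h φ lam p θ α) ω) Θ a

/-! ### The assumptions -/

/-- The estimates `αhat n` exist, that is, they maximize `α ↦ P_n h(θ, α)` over `Θ` with
probability tending to one, and they are consistent. -/
structure AssumptionA0 {𝒳 Ω : Type*} [MeasurableSpace 𝒳] [MeasurableSpace Ω] {d : ℕ}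
    (φ : ℝ → ℝ≥0∞) (lam : Measure 𝒳) (Θ : Set (EuclideanSpace ℝ (Fin d)))
    (p : EuclideanSpace ℝ (Fin d) → 𝒳 → ℝ) (μ : Measure Ω) (X : ℕ → Ω → 𝒳)
    (θ θT : EuclideanSpace ℝ (Fin d)) (αhat : ℕ → Ω → EuclideanSpace ℝ (Fin d)) : Prop where
  exist : Tendsto (fun n => μ {ω | ¬ IsDualEstimate φ lam Θ p X θ n ω (αhat n ω)}) atTop (𝓝 0)
  consistent : TendstoInMeasure μ αhat atTop fun _ => θT

/-- On some neighbourhood `N` of `θT` the first and second order partial derivatives of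
`α ↦ f(θ, α, x) p_θ(x)` are dominated by `lam`-integrable functions of `x`, and the third order
partial derivatives of `α ↦ h(θ, α, x)` exist and are dominated by `P_{θT}`-integrable ones. -/
def AssumptionA1 {𝒳 : Type*} [MeasurableSpace 𝒳] {d : ℕ}
    (φ : ℝ → ℝ≥0∞) (lam : Measure 𝒳) (Θ : Set (EuclideanSpace ℝ (Fin d)))
    (p : EuclideanSpace ℝ (Fin d) → 𝒳 → ℝ) (θ θT : EuclideanSpace ℝ (Fin d)) : Prop :=
  ∃ N : Set (EuclideanSpace ℝ (Fin d)), IsOpen N ∧ θT ∈ N ∧ N ⊆ Θ ∧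
    (∀ i, ∃ F : 𝒳 → ℝ, Integrable F lam ∧ ∀ᵐ x ∂lam, ∀ α ∈ N,
      |pderiv i (fun a => f φ p θ a x * p θ x) α| ≤ F x) ∧
    (∀ i j, ∃ F : 𝒳 → ℝ, Integrable F lam ∧ ∀ᵐ x ∂lam, ∀ α ∈ N,
      |pderiv i (pderiv j fun a => f φ p θ a x * p θ x) α| ≤ F x) ∧
    (∀ i j k, ∃ F : 𝒳 → ℝ, Integrable F (modelMeasure lam p θT) ∧
      ∀ᵐ x ∂(modelMeasure lam p θT), ∀ α ∈ N,
        LineDifferentiableAt ℝ (pderiv j (pderiv k fun a => h φ lam p θ a x)) α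
          (EuclideanSpace.single i 1) ∧
        |pderiv i (pderiv j (pderiv k fun a => h φ lam p θ a x)) α| ≤ F x)

/-- The matrix `S = - P_{θT} (∂²/∂α²) h(θ, θT)`. -/
def matS {𝒳 : Type*} [MeasurableSpace 𝒳] {d : ℕ} (φ : ℝ → ℝ≥0∞) (lam : Measure 𝒳)
    (p : EuclideanSpace ℝ (Fin d) → 𝒳 → ℝ) (θ θT : EuclideanSpace ℝ (Fin d)) :
    Matrix (Fin d) (Fin d) ℝ :=
  -Matrix.of fun i j =>
    ∫ x, pderiv i (pderiv j fun a => h φ lam p θ a x) θT ∂(modelMeasure lam p θT)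

/-- The matrix `M = P_{θT} (∂/∂α) h(θ, θT) (∂/∂α)ᵀ h(θ, θT)`. -/
def matM {𝒳 : Type*} [MeasurableSpace 𝒳] {d : ℕ} (φ : ℝ → ℝ≥0∞) (lam : Measure 𝒳)
    (p : EuclideanSpace ℝ (Fin d) → 𝒳 → ℝ) (θ θT : EuclideanSpace ℝ (Fin d)) :
    Matrix (Fin d) (Fin d) ℝ :=
  Matrix.of fun i j =>
    ∫ x, pderiv i (fun a => h φ lam p θ a x) θT * pderiv j (fun a => h φ lam p θ a x) θT
      ∂(modelMeasure lam p θT)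

/-- The asymptotic covariance matrix `V = S⁻¹ M S⁻¹`. -/
def matV {𝒳 : Type*} [MeasurableSpace 𝒳] {d : ℕ} (φ : ℝ → ℝ≥0∞) (lam : Measure 𝒳)
    (p : EuclideanSpace ℝ (Fin d) → 𝒳 → ℝ) (θ θT : EuclideanSpace ℝ (Fin d)) :
    Matrix (Fin d) (Fin d) ℝ :=
  (matS φ lam p θ θT)⁻¹ * matM φ lam p θ θT * (matS φ lam p θ θT)⁻¹

/-- The integrals `P_{θT} ‖(∂/∂α) h(θ, θT)‖²` and `P_{θT} ‖(∂²/∂α²) h(θ, θT)‖` are finite (stated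
entry by entry) and `P_{θT} (∂²/∂α²) h(θ, θT)` is nonsingular. -/
structure AssumptionA2 {𝒳 : Type*} [MeasurableSpace 𝒳] {d : ℕ}
    (φ : ℝ → ℝ≥0∞) (lam : Measure 𝒳) (p : EuclideanSpace ℝ (Fin d) → 𝒳 → ℝ)
    (θ θT : EuclideanSpace ℝ (Fin d)) : Prop where
  integrable_sq : ∀ i, Integrable (fun x => pderiv i (fun a => h φ lam p θ a x) θT ^ 2)
    (modelMeasure lam p θT)
  integrable_hess : ∀ i j, Integrable
    (fun x => pderiv i (pderiv j fun a => h φ lam p θ a x) θT) (modelMeasure lam p θT)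
  nonsingular : IsUnit (matS φ lam p θ θT).det

/-- The integral `P_{θT} h(θ, θT)²` is finite. -/
def AssumptionA3 {𝒳 : Type*} [MeasurableSpace 𝒳] {d : ℕ}
    (φ : ℝ → ℝ≥0∞) (lam : Measure 𝒳) (p : EuclideanSpace ℝ (Fin d) → 𝒳 → ℝ)
    (θ θT : EuclideanSpace ℝ (Fin d)) : Prop :=
  Integrable (fun x => h φ lam p θ θT x ^ 2) (modelMeasure lam p θT)

/-- `σ²_φ(θ, θT) = P_{θT} h(θ, θT)² - (P_{θT} h(θ, θT))²`. -/
def sigmaSq {𝒳 : Type*} [MeasurableSpace 𝒳] {d : ℕ} (φ : ℝ → ℝ≥0∞) (lam : Measure 𝒳)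
    (p : EuclideanSpace ℝ (Fin d) → 𝒳 → ℝ) (θ θT : EuclideanSpace ℝ (Fin d)) : ℝ :=
  ∫ x, h φ lam p θ θT x ^ 2 ∂(modelMeasure lam p θT)
    - (∫ x, h φ lam p θ θT x ∂(modelMeasure lam p θT)) ^ 2

/-! ### The limit law -/

/-- The chi-square distribution with `d` degrees of freedom: the law of `Z_1² + ⋯ + Z_d²` for
independent standard normal variables `Z_i`. -/
def chiSquare (d : ℕ) : Measure ℝ :=
  (Measure.pi fun _ : Fin d => gaussianReal 0 1).map fun z => ∑ i, z i ^ 2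

instance isProbabilityMeasure_chiSquare (d : ℕ) : IsProbabilityMeasure (chiSquare d) :=
  Measure.isProbabilityMeasure_map (Measurable.aemeasurable (by fun_prop))

end DualDivergence

end

noncomputable section

namespace DualDivergence

/-! ### Partial derivatives -/

section Calculus

variable {d : ℕ}

lemma hasDerivAt_line {u : EuclideanSpace ℝ (Fin d) → ℝ} {a v : EuclideanSpace ℝ (Fin d)} {t : ℝ}
    (hu : LineDifferentiableAt ℝ u (a + t • v) v) :
    HasDerivAt (fun s : ℝ => u (a + s • v)) (lineDeriv ℝ u (a + t • v) v) t := by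
  have h : HasDerivAt (fun s : ℝ => u (a + t • v + s • v)) (lineDeriv ℝ u (a + t • v) v)
      (t - t) := by
    rw [sub_self]; exact hu.hasLineDerivAt
  have := h.comp_sub_const t t
  refine this.congr_of_eventuallyEq (Eventually.of_forall fun s => ?_)
  simp only
  congr 1
  module

/-- A function with partial derivatives bounded by `K` on a ball is Lipschitz at the centre. -/
lemma abs_sub_le_of_abs_pderiv_le {v : EuclideanSpace ℝ (Fin d) → ℝ}
    {x₀ : EuclideanSpace ℝ (Fin d)} {ρ K : ℝ}
    (hv : ∀ α ∈ Metric.closedBall x₀ ρ, ∀ i,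
      LineDifferentiableAt ℝ v α (EuclideanSpace.single i 1))
    (hb : ∀ α ∈ Metric.closedBall x₀ ρ, ∀ i, |pderiv i v α| ≤ K)
    {α : EuclideanSpace ℝ (Fin d)} (hα : α ∈ Metric.closedBall x₀ ρ) :
    |v α - v x₀| ≤ d * K * ρ := by
  suffices H : ∀ s : Finset (Fin d), ∀ α ∈ Metric.closedBall x₀ ρ, (∀ i ∉ s, α i = x₀ i) →
      |v α - v x₀| ≤ s.card * K * ρ by
    simpa using H Finset.univ α hα (by simp)
  intro s
  induction s using Finset.induction_on with
  | empty =>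
    intro α _ h
    have : α = x₀ := by ext i; exact h i (by simp)
    simp [this]
  | insert i s his ih =>
    intro α hα h
    set δ := α i - x₀ i with hδ
    set e : EuclideanSpace ℝ (Fin d) := EuclideanSpace.single i 1
    set β := α - δ • e with hβ
    have hcoord : ∀ t : ℝ, ∀ j, (β + t • e) j = if j = i then x₀ i + t else α j := by
      intro t j
      by_cases hji : j = i
      · subst hji; simp [hβ, e, hδ]
      · simp [hβ, e, hji]
    have hmem : ∀ t : ℝ, |t| ≤ |δ| → β + t • e ∈ Metric.closedBall x₀ ρ := by
      intro t ht
      rw [Metric.mem_closedBall] at hα ⊢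
      refine le_trans ?_ hα
      rw [EuclideanSpace.dist_eq, EuclideanSpace.dist_eq]
      refine Real.sqrt_le_sqrt (Finset.sum_le_sum fun j _ => ?_)
      rw [hcoord]
      split_ifs with hji
      · subst hji
        simp only [Real.dist_eq, add_sub_cancel_left]
        gcongr
      · exact le_rfl
    have hβ' : β + (0 : ℝ) • e = β := by simp
    have hα' : β + δ • e = α := by simp [hβ]
    have h1 : |v β - v x₀| ≤ s.card * K * ρ := by
      refine ih β (by rw [← hβ']; exact hmem 0 (by simp)) fun j hj => ?_
      rw [← hβ', hcoord]
      split_ifs with hji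
      · simp [hji]
      · exact h j (by simp [hji, hj])
    have hK : 0 ≤ K := (abs_nonneg _).trans (hb α hα i)
    have h2 : ‖v (β + δ • e) - v (β + (0 : ℝ) • e)‖ ≤ K * ‖δ - 0‖ := by
      refine Convex.norm_image_sub_le_of_norm_hasDerivWithin_le
        (f := fun t : ℝ => v (β + t • e)) (f' := fun t => lineDeriv ℝ v (β + t • e) e)
        (s := Metric.closedBall (0 : ℝ) |δ|) (fun t ht => ?_) (fun t ht => ?_)
        (convex_closedBall _ _) (by simp) (by simp)
      · rw [mem_closedBall_zero_iff, Real.norm_eq_abs] at ht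
        exact (hasDerivAt_line (hv _ (hmem t ht) i)).hasDerivWithinAt
      · rw [mem_closedBall_zero_iff, Real.norm_eq_abs] at ht
        exact hb _ (hmem t ht) i
    rw [hα', hβ', sub_zero, Real.norm_eq_abs, Real.norm_eq_abs] at h2
    have hδρ : |δ| ≤ ρ := by
      refine le_trans ?_ (mem_closedBall_iff_norm.1 hα)
      simpa [hδ] using PiLp.norm_apply_le (α - x₀) i
    rw [Finset.card_insert_of_notMem his]
    push_cast
    calc |v α - v x₀| ≤ |v α - v β| + |v β - v x₀| := abs_sub_le _ _ _
      _ ≤ K * |δ| + s.card * K * ρ := add_le_add h2 h1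
      _ ≤ K * ρ + s.card * K * ρ := by gcongr
      _ = _ := by ring

lemma hasLineDerivAt_coord (x₀ α : EuclideanSpace ℝ (Fin d)) (i j : Fin d) :
    HasLineDerivAt ℝ (fun a : EuclideanSpace ℝ (Fin d) => a j - x₀ j) (if j = i then 1 else 0) α
      (EuclideanSpace.single i 1) := by
  unfold HasLineDerivAt
  have h : HasDerivAt (fun t : ℝ => α j + t * (if j = i then 1 else 0) - x₀ j)
      (1 * (if j = i then 1 else 0)) 0 :=
    (((hasDerivAt_id (0 : ℝ)).mul_const _).const_add _).sub_const _
  simpa [Pi.single_apply] using h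

lemma hasLineDerivAt_linear (c : Fin d → ℝ) (x₀ α : EuclideanSpace ℝ (Fin d)) (i : Fin d) :
    HasLineDerivAt ℝ (fun a : EuclideanSpace ℝ (Fin d) => ∑ j, c j * (a j - x₀ j)) (c i) α
      (EuclideanSpace.single i 1) := by
  have := HasDerivAt.fun_sum (u := Finset.univ) fun j _ =>
    HasDerivAt.const_mul (c j) (hasLineDerivAt_coord x₀ α i j)
  simpa [HasLineDerivAt] using this

lemma hasLineDerivAt_quadratic (c : Fin d → Fin d → ℝ) (hc : ∀ i j, c i j = c j i)
    (x₀ α : EuclideanSpace ℝ (Fin d)) (i : Fin d) :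
    HasLineDerivAt ℝ (fun a : EuclideanSpace ℝ (Fin d) =>
      2⁻¹ * ∑ k, ∑ j, c j k * (a j - x₀ j) * (a k - x₀ k)) (∑ j, c j i * (α j - x₀ j)) α
      (EuclideanSpace.single i 1) := by
  have := HasDerivAt.const_mul (2⁻¹ : ℝ) <| HasDerivAt.fun_sum (u := Finset.univ) fun k _ =>
    HasDerivAt.fun_sum (u := Finset.univ) fun j _ =>
      HasDerivAt.mul (HasDerivAt.const_mul (c j k) (hasLineDerivAt_coord x₀ α i j))
        (hasLineDerivAt_coord x₀ α i k)
  refine HasDerivAt.congr_deriv this ?_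
  simp only [zero_smul, add_zero, Finset.sum_add_distrib, mul_ite, mul_one, mul_zero, ite_mul,
    zero_mul, Finset.sum_ite_eq', Finset.mem_univ, if_true]
  rw [Finset.sum_comm]
  simp only [Finset.sum_ite_eq', Finset.mem_univ, if_true]
  simp_rw [hc i]
  ring

/-- First order expansion of the partial derivatives of a function whose third order partial
derivatives are bounded. -/
lemma abs_pderiv_sub_le {u : EuclideanSpace ℝ (Fin d) → ℝ} {x₀ : EuclideanSpace ℝ (Fin d)}
    {ρ F : ℝ}
    (h2 : ∀ α ∈ Metric.closedBall x₀ ρ, ∀ j k,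
      LineDifferentiableAt ℝ (pderiv k u) α (EuclideanSpace.single j 1))
    (h3 : ∀ α ∈ Metric.closedBall x₀ ρ, ∀ i j k,
      LineDifferentiableAt ℝ (pderiv j (pderiv k u)) α (EuclideanSpace.single i 1) ∧
        |pderiv i (pderiv j (pderiv k u)) α| ≤ F)
    {α : EuclideanSpace ℝ (Fin d)} (hα : α ∈ Metric.closedBall x₀ ρ) (k : Fin d) :
    |pderiv k u α - pderiv k u x₀ - ∑ j, pderiv j (pderiv k u) x₀ * (α j - x₀ j)| ≤
      d ^ 2 * F * ρ ^ 2 := by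
  have hder : ∀ β ∈ Metric.closedBall x₀ ρ, ∀ i, HasLineDerivAt ℝ
      (fun a => pderiv k u a - ∑ j, pderiv j (pderiv k u) x₀ * (a j - x₀ j))
      (pderiv i (pderiv k u) β - pderiv i (pderiv k u) x₀) β (EuclideanSpace.single i 1) :=
    fun β hβ i => HasDerivAt.sub (h2 β hβ i k).hasLineDerivAt
      (hasLineDerivAt_linear _ x₀ β i)
  have := abs_sub_le_of_abs_pderiv_le (K := d * F * ρ)
    (fun β hβ i => (hder β hβ i).lineDifferentiableAt)
    (fun β hβ i => by
      rw [pderiv, (hder β hβ i).lineDeriv]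
      exact abs_sub_le_of_abs_pderiv_le (fun γ hγ l => (h3 γ hγ l i k).1)
        (fun γ hγ l => (h3 γ hγ l i k).2) hβ) hα
  simp only [sub_self, mul_zero, Finset.sum_const_zero, sub_zero] at this
  calc _ = _ := by congr 1; ring
    _ ≤ _ := this
    _ = _ := by ring

/-- Second order expansion of a function whose third order partial derivatives are bounded. -/
lemma abs_sub_taylor_le {u : EuclideanSpace ℝ (Fin d) → ℝ} {x₀ : EuclideanSpace ℝ (Fin d)}
    {ρ F : ℝ}
    (h1 : ∀ α ∈ Metric.closedBall x₀ ρ, ∀ k,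
      LineDifferentiableAt ℝ u α (EuclideanSpace.single k 1))
    (h2 : ∀ α ∈ Metric.closedBall x₀ ρ, ∀ j k,
      LineDifferentiableAt ℝ (pderiv k u) α (EuclideanSpace.single j 1))
    (h3 : ∀ α ∈ Metric.closedBall x₀ ρ, ∀ i j k,
      LineDifferentiableAt ℝ (pderiv j (pderiv k u)) α (EuclideanSpace.single i 1) ∧
        |pderiv i (pderiv j (pderiv k u)) α| ≤ F)
    (hsymm : ∀ j k, pderiv j (pderiv k u) x₀ = pderiv k (pderiv j u) x₀)
    {α : EuclideanSpace ℝ (Fin d)} (hα : α ∈ Metric.closedBall x₀ ρ) :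
    |u α - u x₀ - ∑ k, pderiv k u x₀ * (α k - x₀ k) -
        2⁻¹ * ∑ k, ∑ j, pderiv j (pderiv k u) x₀ * (α j - x₀ j) * (α k - x₀ k)| ≤
      d ^ 3 * F * ρ ^ 3 := by
  have hder : ∀ β ∈ Metric.closedBall x₀ ρ, ∀ i, HasLineDerivAt ℝ
      (fun a => u a - ∑ k, pderiv k u x₀ * (a k - x₀ k) -
        2⁻¹ * ∑ k, ∑ j, pderiv j (pderiv k u) x₀ * (a j - x₀ j) * (a k - x₀ k))
      (pderiv i u β - pderiv i u x₀ - ∑ j, pderiv j (pderiv i u) x₀ * (β j - x₀ j)) β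
      (EuclideanSpace.single i 1) :=
    fun β hβ i => HasDerivAt.sub (HasDerivAt.sub (h1 β hβ i).hasLineDerivAt
      (hasLineDerivAt_linear _ x₀ β i)) (hasLineDerivAt_quadratic _ hsymm x₀ β i)
  have := abs_sub_le_of_abs_pderiv_le (K := d ^ 2 * F * ρ ^ 2)
    (fun β hβ i => (hder β hβ i).lineDifferentiableAt)
    (fun β hβ i => by
      rw [pderiv, (hder β hβ i).lineDeriv]
      exact abs_pderiv_sub_le h2 h3 hβ i) hα
  simp only [sub_self, mul_zero, Finset.sum_const_zero, sub_zero] at this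
  calc _ = _ := by congr 1; ring
    _ ≤ _ := this
    _ = _ := by ring

lemma pderiv_eq_zero_of_isLocalMax {u : EuclideanSpace ℝ (Fin d) → ℝ}
    {α : EuclideanSpace ℝ (Fin d)} (h : IsLocalMax u α) (i : Fin d) : pderiv i u α = 0 := by
  refine IsLocalExtr.deriv_eq_zero (Or.inr ?_)
  have hc : ContinuousAt (fun t : ℝ => α + t • EuclideanSpace.single i (1 : ℝ)) 0 := by fun_prop
  have h' : IsLocalMax u (α + (0 : ℝ) • EuclideanSpace.single i (1 : ℝ)) := by simpa using h
  exact hc.tendsto.eventually h'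

variable {u : EuclideanSpace ℝ (Fin d) → ℝ} {U : Set (EuclideanSpace ℝ (Fin d))}

lemma lineDifferentiableAt_of_contDiffOn {n : WithTop ℕ∞} (hn : n ≠ 0) (hu : ContDiffOn ℝ n u U)
    (hU : IsOpen U) {α : EuclideanSpace ℝ (Fin d)} (hα : α ∈ U) (v : EuclideanSpace ℝ (Fin d)) :
    LineDifferentiableAt ℝ u α v :=
  ((hu.contDiffAt (hU.mem_nhds hα)).differentiableAt hn).lineDifferentiableAt

lemma pderiv_eq_fderiv {n : WithTop ℕ∞} (hn : n ≠ 0) (hu : ContDiffOn ℝ n u U) (hU : IsOpen U)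
    {α : EuclideanSpace ℝ (Fin d)} (hα : α ∈ U) (i : Fin d) :
    pderiv i u α = fderiv ℝ u α (EuclideanSpace.single i 1) :=
  ((hu.contDiffAt (hU.mem_nhds hα)).differentiableAt hn).lineDeriv_eq_fderiv

lemma contDiffOn_pderiv {n : WithTop ℕ∞} (hu : ContDiffOn ℝ (n + 1) u U) (hU : IsOpen U)
    (i : Fin d) : ContDiffOn ℝ n (pderiv i u) U :=
  ((hu.fderiv_of_isOpen hU le_rfl).clm_apply contDiffOn_const).congr fun _ hα =>
    pderiv_eq_fderiv (by simp) hu hU hα i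

lemma pderiv_pderiv_comm (hu : ContDiffOn ℝ 2 u U) (hU : IsOpen U)
    {α : EuclideanSpace ℝ (Fin d)} (hα : α ∈ U) (i j : Fin d) :
    pderiv i (pderiv j u) α = pderiv j (pderiv i u) α := by
  have hd : DifferentiableAt ℝ (fderiv ℝ u) α :=
    (((hu.contDiffAt (hU.mem_nhds hα)).fderiv_right (m := 1) (by norm_num)).differentiableAt
      (by norm_num))
  have key : ∀ i j : Fin d, pderiv i (pderiv j u) α =
      fderiv ℝ (fderiv ℝ u) α (EuclideanSpace.single i 1) (EuclideanSpace.single j 1) := by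
    intro i j
    have h1 : HasFDerivAt (pderiv j u)
        ((ContinuousLinearMap.apply ℝ ℝ (EuclideanSpace.single j (1 : ℝ))).comp
          (fderiv ℝ (fderiv ℝ u) α)) α := by
      refine HasFDerivAt.congr_of_eventuallyEq
        ((ContinuousLinearMap.hasFDerivAt _).comp α hd.hasFDerivAt) ?_
      filter_upwards [hU.mem_nhds hα] with β hβ
      exact pderiv_eq_fderiv (by norm_num) hu hU hβ j
    rw [pderiv, (h1.hasLineDerivAt _).lineDeriv]
    rfl
  rw [key, key]
  exact (hu.contDiffAt (hU.mem_nhds hα)).isSymmSndFDerivAt (by simp) _ _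

lemma pderiv_congr_of_eqOn {v : EuclideanSpace ℝ (Fin d) → ℝ} (hU : IsOpen U) (h : Set.EqOn u v U)
    {α : EuclideanSpace ℝ (Fin d)} (hα : α ∈ U) (i : Fin d) : pderiv i u α = pderiv i v α :=
  (h.eventuallyEq_of_mem (hU.mem_nhds hα)).lineDeriv_eq

end Calculus

/-! ### Convergence in probability -/

section InMeasure

variable {Ω E : Type*} [MeasurableSpace Ω] {μ : Measure Ω} [NormedAddCommGroup E]

/-- Domination outside of events of probability tending to zero. -/
lemma tendstoInMeasure_zero_of_norm_le {Y : ℕ → Ω → E} {R : ℕ → Ω → ℝ} {B : ℕ → Set Ω}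
    (hB : Tendsto (fun n => μ (B n)) atTop (𝓝 0))
    (hR : TendstoInMeasure μ R atTop fun _ => 0) (h : ∀ n, ∀ ω ∉ B n, ‖Y n ω‖ ≤ R n ω) :
    TendstoInMeasure μ Y atTop fun _ => 0 := by
  rw [tendstoInMeasure_iff_norm] at hR ⊢
  intro ε hε
  have := hB.add (hR ε hε)
  rw [add_zero] at this
  refine tendsto_of_tendsto_of_tendsto_of_le_of_le tendsto_const_nhds this (fun _ => zero_le)
    fun n => (measure_mono fun ω hω => ?_).trans (measure_union_le (B n) _)
  by_cases hωB : ω ∈ B n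
  · exact Or.inl hωB
  · refine Or.inr ?_
    simp only [sub_zero, Set.mem_ofPred_eq] at hω ⊢
    exact hω.trans ((h n ω hωB).trans (le_abs_self _))

lemma tendsto_measure_union_zero {A B : ℕ → Set Ω} (hA : Tendsto (fun n => μ (A n)) atTop (𝓝 0))
    (hB : Tendsto (fun n => μ (B n)) atTop (𝓝 0)) :
    Tendsto (fun n => μ (A n ∪ B n)) atTop (𝓝 0) := by
  have := hA.add hB
  rw [add_zero] at this
  exact tendsto_of_tendsto_of_tendsto_of_le_of_le tendsto_const_nhds this (fun _ => zero_le)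
    fun n => measure_union_le _ _

lemma tendsto_measure_le_norm {Y : ℕ → Ω → E} (hY : TendstoInMeasure μ Y atTop fun _ => 0)
    {ε : ℝ} (hε : 0 < ε) : Tendsto (fun n => μ {ω | ε ≤ ‖Y n ω‖}) atTop (𝓝 0) := by
  simpa using tendstoInMeasure_iff_norm.1 hY ε hε

lemma tendstoInMeasure_zero_add {Y W : ℕ → Ω → E} (hY : TendstoInMeasure μ Y atTop fun _ => 0)
    (hW : TendstoInMeasure μ W atTop fun _ => 0) :
    TendstoInMeasure μ (fun n ω => Y n ω + W n ω) atTop fun _ => 0 := by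
  rw [tendstoInMeasure_iff_norm]
  intro ε hε
  refine tendsto_of_tendsto_of_tendsto_of_le_of_le tendsto_const_nhds
    (tendsto_measure_union_zero (tendsto_measure_le_norm hY (half_pos hε))
      (tendsto_measure_le_norm hW (half_pos hε))) (fun _ => zero_le)
    fun n => measure_mono fun ω hω => ?_
  simp only [sub_zero, Set.mem_ofPred_eq, Set.mem_union] at hω ⊢
  by_contra! hc
  linarith [norm_add_le (Y n ω) (W n ω)]

lemma tendstoInMeasure_zero_const : TendstoInMeasure μ (fun (_ : ℕ) (_ : Ω) => (0 : E)) atTop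
    fun _ => 0 := by
  rw [tendstoInMeasure_iff_norm]
  intro ε hε
  simp [hε.not_ge]

lemma tendstoInMeasure_zero_sum {κ : Type*} (s : Finset κ) {Y : κ → ℕ → Ω → E}
    (hY : ∀ k ∈ s, TendstoInMeasure μ (Y k) atTop fun _ => 0) :
    TendstoInMeasure μ (fun n ω => ∑ k ∈ s, Y k n ω) atTop fun _ => 0 := by
  classical
  induction s using Finset.induction_on with
  | empty => simpa using tendstoInMeasure_zero_const
  | insert k s hk ih =>
    simp_rw [Finset.sum_insert hk]
    exact tendstoInMeasure_zero_add (hY k (by simp)) (ih fun j hj => hY j (by simp [hj]))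

lemma tendstoInMeasure_zero_norm {Y : ℕ → Ω → E} (hY : TendstoInMeasure μ Y atTop fun _ => 0) :
    TendstoInMeasure μ (fun n ω => ‖Y n ω‖) atTop fun _ => 0 := by
  rw [tendstoInMeasure_iff_norm] at hY ⊢
  simpa using hY

lemma tendstoInMeasure_zero_const_mul {Y : ℕ → Ω → ℝ}
    (hY : TendstoInMeasure μ Y atTop fun _ => 0) (c : ℝ) :
    TendstoInMeasure μ (fun n ω => c * Y n ω) atTop fun _ => 0 := by
  rw [tendstoInMeasure_iff_norm]
  intro ε hε
  have hc : 0 < |c| + 1 := by positivity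
  refine tendsto_of_tendsto_of_tendsto_of_le_of_le tendsto_const_nhds
    (tendsto_measure_le_norm hY (div_pos hε hc)) (fun _ => zero_le)
    fun n => measure_mono fun ω hω => ?_
  simp only [sub_zero, Set.mem_ofPred_eq, norm_mul, Real.norm_eq_abs] at hω ⊢
  rw [div_le_iff₀ hc]
  nlinarith [abs_nonneg (Y n ω)]

lemma tendstoInMeasure_sub_const {Y : ℕ → Ω → E} {c : E}
    (hY : TendstoInMeasure μ Y atTop fun _ => c) :
    TendstoInMeasure μ (fun n ω => Y n ω - c) atTop fun _ => 0 := by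
  rw [tendstoInMeasure_iff_norm] at hY ⊢
  simpa using hY

variable [MeasurableSpace E] [BorelSpace E] [IsProbabilityMeasure μ]

/-- Convergence in distribution to zero implies convergence in probability. -/
lemma tendstoInMeasure_zero_of_tendstoInDistribution {Ω' : Type*} [MeasurableSpace Ω']
    {ν : Measure Ω'} [IsProbabilityMeasure ν] {Y : ℕ → Ω → E}
    (h : TendstoInDistribution Y atTop (fun _ : Ω' => (0 : E)) (fun _ => μ) ν) :
    TendstoInMeasure μ Y atTop fun _ => 0 := by
  rw [tendstoInMeasure_iff_norm]
  intro ε hε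
  have hF : IsClosed {x : E | ε ≤ ‖x‖} := isClosed_le continuous_const continuous_norm
  have h1 := ProbabilityMeasure.limsup_measure_closed_le_of_tendsto h.tendsto hF
  have h2 : ∀ n, (μ.map (Y n)) {x : E | ε ≤ ‖x‖} = μ {ω | ε ≤ ‖Y n ω‖} := fun n =>
    Measure.map_apply_of_aemeasurable (h.forall_aemeasurable n) hF.measurableSet
  simp only [ProbabilityMeasure.coe_mk, h2] at h1
  rw [Measure.map_const, measure_univ, one_smul, Measure.dirac_apply' _ hF.measurableSet,
    Set.indicator_of_notMem (by simpa using hε)] at h1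
  simp only [sub_zero]
  exact tendsto_of_le_liminf_of_limsup_le zero_le h1

/-- A sequence converging in distribution, times one that converges to zero in probability. -/
lemma tendstoInMeasure_zero_mul [SecondCountableTopology E] {Ω' : Type*} [MeasurableSpace Ω']
    {ν : Measure Ω'} [IsProbabilityMeasure ν] {Y : ℕ → Ω → E} {Z : Ω' → E}
    (hY : TendstoInDistribution Y atTop Z (fun _ => μ) ν) {R : ℕ → Ω → ℝ}
    (hR : TendstoInMeasure μ R atTop fun _ => 0) (hRm : ∀ n, AEMeasurable (R n) μ) {q : E → ℝ}
    (hq : Continuous q) :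
    TendstoInMeasure μ (fun n ω => R n ω * q (Y n ω)) atTop fun _ => 0 := by
  have := TendstoInDistribution.continuous_comp_prodMk_of_tendstoInMeasure_const
    (g := fun z : E × ℝ => z.2 * q z.1) (by fun_prop) hY hR hRm
  simp only [zero_mul] at this
  exact tendstoInMeasure_zero_of_tendstoInDistribution this

end InMeasure

/-! ### Empirical means -/

section Empirical

variable {𝒳 Ω : Type*} [MeasurableSpace 𝒳] [MeasurableSpace Ω] {P : Measure 𝒳}
  {μ : Measure Ω} {X : ℕ → Ω → 𝒳}

lemma aemeasurable_comp_of_hasLaw {β : Type*} [MeasurableSpace β]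
    (hlaw : ∀ i, HasLaw (X i) P μ) {u : 𝒳 → β} (hu : AEMeasurable u P) (i : ℕ) :
    AEMeasurable (fun ω => u (X i ω)) μ := by
  rw [← (hlaw i).map_eq] at hu
  exact hu.comp_aemeasurable (hlaw i).aemeasurable

lemma iIndepFun_comp_of_hasLaw {β : Type*} [MeasurableSpace β] (hlaw : ∀ i, HasLaw (X i) P μ)
    (hindep : iIndepFun X μ) {u : 𝒳 → β} (hu : AEMeasurable u P) :
    iIndepFun (fun i ω => u (X i ω)) μ :=
  hindep.comp₀ (fun _ => u) (fun i => (hlaw i).aemeasurable) fun i => by rwa [(hlaw i).map_eq]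

lemma identDistrib_comp_of_hasLaw {β : Type*} [MeasurableSpace β] (hlaw : ∀ i, HasLaw (X i) P μ)
    {u : 𝒳 → β} (hu : AEMeasurable u P) (i : ℕ) :
    IdentDistrib (fun ω => u (X i ω)) (fun ω => u (X 0 ω)) μ μ := by
  refine IdentDistrib.comp_of_aemeasurable (u := u)
    ⟨(hlaw i).aemeasurable, (hlaw 0).aemeasurable, ?_⟩ ?_
  · rw [(hlaw i).map_eq, (hlaw 0).map_eq]
  · rwa [(hlaw i).map_eq]

lemma aemeasurable_empMean (hlaw : ∀ i, HasLaw (X i) P μ) {u : 𝒳 → ℝ} (hu : AEMeasurable u P)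
    (n : ℕ) : AEMeasurable (empMean X n u) μ :=
  (Finset.aemeasurable_fun_sum _ fun i _ => aemeasurable_comp_of_hasLaw hlaw hu i).const_mul _

/-- The law of large numbers. -/
lemma tendstoInMeasure_empMean [IsProbabilityMeasure μ] (hlaw : ∀ i, HasLaw (X i) P μ)
    (hindep : iIndepFun X μ) {u : 𝒳 → ℝ} (hu : Integrable u P) :
    TendstoInMeasure μ (fun n => empMean X n u) atTop fun _ => ∫ x, u x ∂P := by
  have hm := hu.aemeasurable
  have hint : Integrable (fun ω => u (X 0 ω)) μ := by
    rw [← (hlaw 0).map_eq] at hu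
    exact hu.comp_aemeasurable (hlaw 0).aemeasurable
  have h := strong_law_ae (fun i ω => u (X i ω)) hint
    (fun i j hij => (iIndepFun_comp_of_hasLaw hlaw hindep hm).indepFun hij)
    (identDistrib_comp_of_hasLaw hlaw hm)
  have h0 : ∫ ω, u (X 0 ω) ∂μ = ∫ x, u x ∂P :=
    (hlaw 0).integral_comp hu.aestronglyMeasurable
  refine tendstoInMeasure_of_tendsto_ae
    (fun n => (aemeasurable_empMean hlaw hm n).aestronglyMeasurable) ?_
  filter_upwards [h] with ω hω
  simpa [empMean, h0] using hω

lemma ae_forall_comp_of_hasLaw (hlaw : ∀ i, HasLaw (X i) P μ) {q : 𝒳 → Prop}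
    (hq : ∀ᵐ x ∂P, q x) : ∀ᵐ ω ∂μ, ∀ i, q (X i ω) :=
  ae_all_iff.2 fun i => ae_of_ae_map (hlaw i).aemeasurable (by rwa [(hlaw i).map_eq])

variable [IsProbabilityMeasure μ]

/-- The central limit theorem for empirical means. -/
lemma tendstoInDistribution_empMean (hlaw : ∀ i, HasLaw (X i) P μ) (hindep : iIndepFun X μ)
    [IsProbabilityMeasure P] {u : 𝒳 → ℝ} (hu : MemLp u 2 P) {v : NNReal}
    (hv : Var[u; P].toNNReal = v) :
    TendstoInDistribution (fun (n : ℕ) ω => √(n : ℝ) * (empMean X n u ω - ∫ x, u x ∂P)) atTop id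
      (fun _ => μ) (gaussianReal 0 v) := by
  have hm : AEMeasurable u P := hu.aestronglyMeasurable.aemeasurable
  have h0 : ∫ ω, u (X 0 ω) ∂μ = ∫ x, u x ∂P := (hlaw 0).integral_comp hu.aestronglyMeasurable
  have hL : MemLp (fun ω => u (X 0 ω)) 2 μ := by
    rw [← (hlaw 0).map_eq] at hu
    exact hu.comp_of_map (hlaw 0).aemeasurable
  have hvar : Var[fun ω => u (X 0 ω); μ] = Var[u; P] := by
    have := (hlaw 0).map_eq
    rw [← this, variance_map (by rwa [this]) (hlaw 0).aemeasurable]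
    rfl
  have h := tendstoInDistribution_inv_sqrt_mul_sum_sub (P := μ) (X := fun i ω => u (X i ω))
    (Y := id) (P' := gaussianReal 0 v)
    (by rw [hvar, hv]; exact HasLaw.id) hL
    (iIndepFun_comp_of_hasLaw hlaw hindep hm) (identDistrib_comp_of_hasLaw hlaw hm)
  refine h.congr (fun n => Eventually.of_forall fun ω => ?_) ae_eq_rfl
  simp only [empMean, h0]
  rcases Nat.eq_zero_or_pos n with rfl | hn
  · simp
  · have : (0 : ℝ) < n := by exact_mod_cast hn
    have hs : √(n : ℝ) ≠ 0 := (Real.sqrt_pos.2 this).ne'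
    have hs2 : √(n : ℝ) * √(n : ℝ) = n := Real.mul_self_sqrt this.le
    field_simp
    rw [sq, hs2]

/-- The multivariate central limit theorem for centred empirical means. -/
lemma tendstoInDistribution_empMean_vector {d : ℕ} (hlaw : ∀ i, HasLaw (X i) P μ)
    (hindep : iIndepFun X μ) [IsProbabilityMeasure P] {ψ : Fin d → 𝒳 → ℝ}
    (hψ : ∀ i, MemLp (ψ i) 2 P) (h0 : ∀ i, ∫ x, ψ i x ∂P = 0) {M : Matrix (Fin d) (Fin d) ℝ}
    (hM : ∀ i j, M i j = ∫ x, ψ i x * ψ j x ∂P) :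
    M.PosSemidef ∧
    TendstoInDistribution (fun (n : ℕ) ω => √(n : ℝ) •
      (WithLp.toLp 2 fun i => empMean X n (ψ i) ω : EuclideanSpace ℝ (Fin d))) atTop id
      (fun _ => μ) (multivariateGaussian 0 M) := by
  have hint : ∀ i j, Integrable (fun x => ψ i x * ψ j x) P := fun i j =>
    (hψ i).integrable_mul (hψ j)
  have hquad : ∀ t : Fin d → ℝ, ∫ x, (∑ i, t i * ψ i x) ^ 2 ∂P = t ⬝ᵥ M *ᵥ t := by
    intro t
    have : ∀ x, (∑ i, t i * ψ i x) ^ 2 = ∑ i, ∑ j, t i * t j * (ψ i x * ψ j x) := by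
      intro x
      rw [sq, Finset.sum_mul_sum]
      exact Finset.sum_congr rfl fun i _ => Finset.sum_congr rfl fun j _ => by ring
    simp_rw [this]
    rw [integral_finsetSum _ fun i _ => integrable_finsetSum _ fun j _ => (hint i j).const_mul _]
    simp only [dotProduct, Matrix.mulVec, Finset.mul_sum]
    refine Finset.sum_congr rfl fun i _ => ?_
    rw [integral_finsetSum _ fun j _ => (hint i j).const_mul _]
    refine Finset.sum_congr rfl fun j _ => ?_
    rw [integral_const_mul, hM]
    ring
  have hpsd : M.PosSemidef := by
    refine Matrix.PosSemidef.of_dotProduct_mulVec_nonneg ?_ fun t => ?_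
    · ext i j
      simp only [Matrix.conjTranspose_apply, hM, star_trivial]
      simp_rw [mul_comm]
    · rw [star_trivial, ← hquad]
      exact integral_nonneg fun x => sq_nonneg _
  refine ⟨hpsd, ?_⟩
  have hmeas : ∀ n : ℕ, AEMeasurable (fun ω => √(n : ℝ) •
      (WithLp.toLp 2 fun i => empMean X n (ψ i) ω : EuclideanSpace ℝ (Fin d))) μ := by
    intro n
    suffices h : AEMeasurable (fun ω =>
        (WithLp.toLp 2 fun i => empMean X n (ψ i) ω : EuclideanSpace ℝ (Fin d))) μ from
      h.const_smul (√(n : ℝ))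
    refine (WithLp.measurable_toLp 2 _).comp_aemeasurable (aemeasurable_pi_lambda _ fun i => ?_)
    exact aemeasurable_empMean hlaw (hψ i).aestronglyMeasurable.aemeasurable n
  refine ⟨hmeas, aemeasurable_id, ProbabilityMeasure.tendsto_iff_tendsto_charFun.2 fun t => ?_⟩
  set u : 𝒳 → ℝ := fun x => ∑ i, t i * ψ i x with hu
  have huL : MemLp u 2 P := memLp_finsetSum _ fun i _ => (hψ i).const_mul _
  have hu0 : ∫ x, u x ∂P = 0 := by
    rw [hu, integral_finsetSum _ fun i _ => ((hψ i).integrable one_le_two).const_mul _]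
    simp [integral_const_mul, h0]
  have hvar : Var[u; P] = t.ofLp ⬝ᵥ M *ᵥ t.ofLp := by
    rw [variance_of_integral_eq_zero huL.aestronglyMeasurable.aemeasurable hu0, ← hquad]
  have hclt := (ProbabilityMeasure.tendsto_iff_tendsto_charFun.1
    (tendstoInDistribution_empMean hlaw hindep huL rfl).tendsto) 1
  simp only [ProbabilityMeasure.coe_mk, Measure.map_id] at hclt ⊢
  rw [charFun_multivariateGaussian hpsd]
  rw [charFun_gaussianReal] at hclt
  have hlim : Complex.exp (((1 : ℝ) : ℂ) * ((0 : ℝ) : ℂ) * Complex.I -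
      (Var[u; P].toNNReal : ℂ) * ((1 : ℝ) : ℂ) ^ 2 / 2) =
      Complex.exp (inner ℝ t (0 : EuclideanSpace ℝ (Fin d)) * Complex.I -
        (t.ofLp ⬝ᵥ M *ᵥ t.ofLp : ℝ) / 2) := by
    congr 1
    have : ((Var[u; P].toNNReal : ℝ) : ℂ) = ((t.ofLp ⬝ᵥ M *ᵥ t.ofLp : ℝ) : ℂ) := by
      rw [Real.coe_toNNReal _ (variance_nonneg _ _), hvar]
    simp only [inner_zero_right, Complex.ofReal_zero, Complex.ofReal_one]
    rw [← this]
    simp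
  refine (hlim ▸ hclt).congr fun n => ?_
  rw [charFun_apply, charFun_apply, integral_map (hmeas n) (by fun_prop), integral_map
    (by
      refine AEMeasurable.const_mul (AEMeasurable.sub_const ?_ _) _
      exact aemeasurable_empMean hlaw huL.aestronglyMeasurable.aemeasurable n)
    (by fun_prop)]
  congr 1
  ext ω
  have : √(n : ℝ) * (empMean X n u ω - ∫ x, u x ∂P) = inner ℝ (√(n : ℝ) •
      (WithLp.toLp 2 fun i => empMean X n (ψ i) ω : EuclideanSpace ℝ (Fin d))) t := by
    rw [hu0, sub_zero, inner_smul_left]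
    simp only [PiLp.inner_apply, empMean, hu, RCLike.inner_apply, conj_trivial]
    congr 1
    simp_rw [Finset.mul_sum]
    rw [Finset.sum_comm]
    exact Finset.sum_congr rfl fun i _ => Finset.sum_congr rfl fun j _ => by ring
  rw [this]
  simp

end Empirical

/-! ### Asymptotics of estimators solving a linearised equation -/

section Estimator

variable {Ω : Type*} [MeasurableSpace Ω] {μ : Measure Ω} {d : ℕ}

lemma norm_le_sum_abs (x : EuclideanSpace ℝ (Fin d)) : ‖x‖ ≤ ∑ i, |x i| := by
  rw [EuclideanSpace.norm_eq, Real.sqrt_le_left (Finset.sum_nonneg fun i _ => abs_nonneg _)]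
  simp only [Real.norm_eq_abs]
  exact Finset.sum_sq_le_sq_sum_of_nonneg fun i _ => abs_nonneg _

lemma abs_apply_le_norm (x : EuclideanSpace ℝ (Fin d)) (i : Fin d) : |x i| ≤ ‖x‖ := by
  simpa using PiLp.norm_apply_le x i

/-- The size of the remainder in the linearised estimating equation. -/
def remainder (S : Matrix (Fin d) (Fin d) ℝ) (H : Fin d → Fin d → ℝ) (F : ℝ)
    (δ : EuclideanSpace ℝ (Fin d)) : ℝ :=
  ∑ j, ∑ k, |H j k + S j k| + d ^ 3 * (|F| * ‖δ‖)

lemma remainder_nonneg (S : Matrix (Fin d) (Fin d) ℝ) (H : Fin d → Fin d → ℝ) (F : ℝ)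
    (δ : EuclideanSpace ℝ (Fin d)) : 0 ≤ remainder S H F δ := by
  unfold remainder; positivity

lemma norm_sub_le_remainder {S : Matrix (Fin d) (Fin d) ℝ} (hS : S.IsSymm)
    {H : Fin d → Fin d → ℝ} {F : ℝ} {δ ψ : EuclideanSpace ℝ (Fin d)}
    (h : ∀ k, |ψ k + ∑ j, H j k * δ j| ≤ d ^ 2 * F * ‖δ‖ ^ 2) :
    ‖Matrix.toEuclideanCLM (𝕜 := ℝ) S δ - ψ‖ ≤ remainder S H F δ * ‖δ‖ := by
  refine (norm_le_sum_abs _).trans ?_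
  have hk : ∀ k, |(Matrix.toEuclideanCLM (𝕜 := ℝ) S δ - ψ) k| ≤
      ∑ j, |H j k + S j k| * ‖δ‖ + d ^ 2 * |F| * ‖δ‖ ^ 2 := by
    intro k
    have e : (Matrix.toEuclideanCLM (𝕜 := ℝ) S δ - ψ) k =
        ∑ j, (H j k + S j k) * δ j - (ψ k + ∑ j, H j k * δ j) := by
      simp only [PiLp.sub_apply, Matrix.ofLp_toEuclideanCLM, Matrix.mulVec, dotProduct, add_mul,
        Finset.sum_add_distrib]
      simp_rw [hS.apply k]
      ring
    rw [e]
    refine (abs_sub _ _).trans (add_le_add ?_ ((h k).trans ?_))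
    · refine (Finset.abs_sum_le_sum_abs _ _).trans (Finset.sum_le_sum fun j _ => ?_)
      rw [abs_mul]
      gcongr
      exact abs_apply_le_norm δ j
    · gcongr
      exact le_abs_self F
  refine (Finset.sum_le_sum fun k _ => hk k).trans (le_of_eq ?_)
  simp only [remainder, Finset.sum_add_distrib, Finset.sum_const, Finset.card_univ,
    Fintype.card_fin, nsmul_eq_mul]
  rw [Finset.sum_comm]
  simp_rw [← Finset.sum_mul]
  ring

lemma abs_value_sub_le_remainder {S : Matrix (Fin d) (Fin d) ℝ}
    {H : Fin d → Fin d → ℝ} {F D a : ℝ} {δ ψ : EuclideanSpace ℝ (Fin d)}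
    (h : ∀ k, |ψ k + ∑ j, H j k * δ j| ≤ d ^ 2 * F * ‖δ‖ ^ 2)
    (hD : |D - a - ∑ k, ψ k * δ k - 2⁻¹ * ∑ k, ∑ j, H j k * δ j * δ k| ≤ d ^ 3 * F * ‖δ‖ ^ 3) :
    |D - a - 2⁻¹ * ∑ k, ∑ j, S j k * δ j * δ k| ≤ 2 * remainder S H F δ * ‖δ‖ ^ 2 := by
  have e : D - a - 2⁻¹ * ∑ k, ∑ j, S j k * δ j * δ k =
      (D - a - ∑ k, ψ k * δ k - 2⁻¹ * ∑ k, ∑ j, H j k * δ j * δ k) +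
      ∑ k, (ψ k + ∑ j, H j k * δ j) * δ k -
      2⁻¹ * ∑ k, ∑ j, (H j k + S j k) * δ j * δ k := by
    simp only [add_mul, Finset.sum_add_distrib, Finset.sum_mul]
    ring
  have h1 : |∑ k, (ψ k + ∑ j, H j k * δ j) * δ k| ≤ d ^ 3 * |F| * ‖δ‖ ^ 3 := by
    refine (Finset.abs_sum_le_sum_abs _ _).trans ?_
    calc _ ≤ ∑ k : Fin d, (d ^ 2 * |F| * ‖δ‖ ^ 2) * ‖δ‖ := by
          refine Finset.sum_le_sum fun k _ => ?_
          rw [abs_mul]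
          refine mul_le_mul ((h k).trans ?_) (abs_apply_le_norm δ k) (abs_nonneg _) (by positivity)
          gcongr
          exact le_abs_self F
      _ = _ := by simp; ring
  have h2 : |∑ k, ∑ j, (H j k + S j k) * δ j * δ k| ≤ (∑ j, ∑ k, |H j k + S j k|) * ‖δ‖ ^ 2 := by
    refine (Finset.abs_sum_le_sum_abs _ _).trans ?_
    rw [Finset.sum_comm, Finset.sum_mul]
    refine Finset.sum_le_sum fun k _ => (Finset.abs_sum_le_sum_abs _ _).trans ?_
    rw [Finset.sum_mul]
    refine Finset.sum_le_sum fun j _ => ?_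
    rw [abs_mul, abs_mul, mul_assoc, sq]
    gcongr
    · exact abs_apply_le_norm δ j
    · exact abs_apply_le_norm δ k
  have h3 : (d : ℝ) ^ 3 * F * ‖δ‖ ^ 3 ≤ d ^ 3 * |F| * ‖δ‖ ^ 3 := by
    gcongr
    exact le_abs_self F
  have h4 : 0 ≤ (∑ j, ∑ k, |H j k + S j k|) * ‖δ‖ ^ 2 := by positivity
  rw [e]
  refine (abs_sub _ _).trans ?_
  refine (add_le_add ((abs_add_le _ _).trans (add_le_add (hD.trans h3) h1)) le_rfl).trans ?_
  rw [abs_mul, abs_of_pos (by norm_num : (0 : ℝ) < 2⁻¹)]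
  have : 2 * remainder S H F δ * ‖δ‖ ^ 2 =
      2 * ((∑ j, ∑ k, |H j k + S j k|) * ‖δ‖ ^ 2) + 2 * (d ^ 3 * |F| * ‖δ‖ ^ 3) := by
    unfold remainder; ring
  rw [this]
  linarith

variable {S : Matrix (Fin d) (Fin d) ℝ} {H : Fin d → Fin d → ℕ → Ω → ℝ} {F : ℕ → Ω → ℝ}
  {δ ψ : ℕ → Ω → EuclideanSpace ℝ (Fin d)}

lemma aemeasurable_remainder (hHm : ∀ j k n, AEMeasurable (H j k n) μ)
    (hFm : ∀ n, AEMeasurable (F n) μ) (hδm : ∀ n, AEMeasurable (δ n) μ) (n : ℕ) :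
    AEMeasurable (fun ω => remainder S (fun j k => H j k n ω) (F n ω) (δ n ω)) μ := by
  unfold remainder
  refine AEMeasurable.add (Finset.aemeasurable_fun_sum _ fun j _ =>
    Finset.aemeasurable_fun_sum _ fun k _ => ?_) (AEMeasurable.const_mul ?_ _)
  · exact ((hHm j k n).add_const _).abs
  · exact (hFm n).abs.mul (hδm n).norm

variable [IsProbabilityMeasure μ]

lemma tendstoInMeasure_remainder (hFm : ∀ n, AEMeasurable (F n) μ)
    (hδm : ∀ n, AEMeasurable (δ n) μ)
    (hH : ∀ j k, TendstoInMeasure μ (H j k) atTop fun _ => -S j k) {c : ℝ}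
    (hF : TendstoInMeasure μ F atTop fun _ => c) (hδ : TendstoInMeasure μ δ atTop fun _ => 0) :
    TendstoInMeasure μ (fun n ω => remainder S (fun j k => H j k n ω) (F n ω) (δ n ω)) atTop
      fun _ => 0 := by
  unfold remainder
  refine tendstoInMeasure_zero_add (tendstoInMeasure_zero_sum _ fun j _ =>
    tendstoInMeasure_zero_sum _ fun k _ => ?_) ?_
  · have := tendstoInMeasure_zero_norm (tendstoInMeasure_sub_const (hH j k))
    simpa only [sub_neg_eq_add, Real.norm_eq_abs] using this
  · have := tendstoInMeasure_zero_mul (hF.tendstoInDistribution hFm)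
      (tendstoInMeasure_zero_norm hδ) (fun n => (hδm n).norm)
      (q := fun y => d ^ 3 * |y|) (by fun_prop)
    refine this.congr_left fun n => Eventually.of_forall fun ω => ?_
    simp only
    ring

/-- If `δ` approximately solves `S δ = ψ`, then `√n δ` is asymptotically equivalent to
`S⁻¹ √n ψ`. -/
lemma tendstoInMeasure_sqrt_smul_sub {Ω' : Type*} [MeasurableSpace Ω'] {ν : Measure Ω'}
    [IsProbabilityMeasure ν] {Z : Ω' → EuclideanSpace ℝ (Fin d)} (hdet : IsUnit S.det)
    {R : ℕ → Ω → ℝ} (hRm : ∀ n, AEMeasurable (R n) μ)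
    (hR : TendstoInMeasure μ R atTop fun _ => 0) (hR0 : ∀ n ω, 0 ≤ R n ω)
    (hψ : TendstoInDistribution (fun (n : ℕ) ω => √(n : ℝ) • ψ n ω) atTop Z (fun _ => μ) ν)
    {B : ℕ → Set Ω} (hB : Tendsto (fun n => μ (B n)) atTop (𝓝 0))
    (h : ∀ n, ∀ ω ∉ B n,
      ‖Matrix.toEuclideanCLM (𝕜 := ℝ) S (δ n ω) - ψ n ω‖ ≤ R n ω * ‖δ n ω‖) :
    TendstoInMeasure μ (fun (n : ℕ) ω => √(n : ℝ) • δ n ω -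
      Matrix.toEuclideanCLM (𝕜 := ℝ) S⁻¹ (√(n : ℝ) • ψ n ω)) atTop fun _ => 0 := by
  set T := Matrix.toEuclideanCLM (𝕜 := ℝ) S⁻¹ with hT
  have hTS : ∀ x, T (Matrix.toEuclideanCLM (𝕜 := ℝ) S x) = x := by
    intro x
    rw [hT, ← mul_apply_eq_comp, ← map_mul, Matrix.nonsing_inv_mul _ hdet, map_one,
      one_apply_eq_self]
  set C := ‖T‖ + 1 with hC
  have hC1 : 0 < C := by positivity
  have hCT : ‖T‖ ≤ C := by linarith
  have hB' := tendsto_measure_union_zero hB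
    (tendsto_measure_le_norm hR (ε := (2 * C)⁻¹) (by positivity))
  refine tendstoInMeasure_zero_of_norm_le hB'
    (tendstoInMeasure_zero_mul hψ hR hRm (q := fun z => 2 * C ^ 2 * ‖z‖) (by fun_prop))
    fun n ω hω => ?_
  simp only [Set.mem_union, Set.mem_ofPred_eq, not_or, not_le] at hω
  obtain ⟨hω1, hω2⟩ := hω
  rw [Real.norm_eq_abs, abs_of_nonneg (hR0 n ω)] at hω2
  have h1 : ‖δ n ω - T (ψ n ω)‖ ≤ C * (R n ω * ‖δ n ω‖) := by
    have : δ n ω - T (ψ n ω) = T (Matrix.toEuclideanCLM (𝕜 := ℝ) S (δ n ω) - ψ n ω) := by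
      rw [map_sub, hTS]
    rw [this]
    exact (T.le_opNorm _).trans (mul_le_mul hCT (h n ω hω1) (norm_nonneg _) hC1.le)
  have h2 : ‖δ n ω‖ ≤ 2 * C * ‖ψ n ω‖ := by
    have h3 : ‖δ n ω‖ ≤ ‖T (ψ n ω)‖ + ‖δ n ω - T (ψ n ω)‖ := norm_le_insert' _ _
    have h4 : ‖T (ψ n ω)‖ ≤ C * ‖ψ n ω‖ :=
      (T.le_opNorm _).trans (mul_le_mul_of_nonneg_right hCT (norm_nonneg _))
    have h5 : C * (R n ω * ‖δ n ω‖) ≤ 2⁻¹ * ‖δ n ω‖ := by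
      rw [← mul_assoc]
      refine mul_le_mul_of_nonneg_right ?_ (norm_nonneg _)
      calc C * R n ω ≤ C * (2 * C)⁻¹ := by gcongr
        _ = 2⁻¹ := by field_simp
    linarith
  rw [map_smul, ← smul_sub, norm_smul, norm_smul, Real.norm_eq_abs, abs_of_nonneg (by positivity)]
  calc √(n : ℝ) * ‖δ n ω - T (ψ n ω)‖ ≤ √(n : ℝ) * (C * (R n ω * (2 * C * ‖ψ n ω‖))) := by
        refine mul_le_mul_of_nonneg_left (h1.trans ?_) (by positivity)
        have := hR0 n ω
        gcongr
    _ = _ := by ring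

/-- The asymptotic law of the estimates. -/
lemma tendstoInDistribution_sqrt_smul {Ω' : Type*} [MeasurableSpace Ω'] {ν : Measure Ω'}
    [IsProbabilityMeasure ν] {Z : Ω' → EuclideanSpace ℝ (Fin d)} (hdet : IsUnit S.det)
    (hδm : ∀ n, AEMeasurable (δ n) μ)
    {R : ℕ → Ω → ℝ} (hRm : ∀ n, AEMeasurable (R n) μ)
    (hR : TendstoInMeasure μ R atTop fun _ => 0) (hR0 : ∀ n ω, 0 ≤ R n ω)
    (hψ : TendstoInDistribution (fun (n : ℕ) ω => √(n : ℝ) • ψ n ω) atTop Z (fun _ => μ) ν)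
    {B : ℕ → Set Ω} (hB : Tendsto (fun n => μ (B n)) atTop (𝓝 0))
    (h : ∀ n, ∀ ω ∉ B n,
      ‖Matrix.toEuclideanCLM (𝕜 := ℝ) S (δ n ω) - ψ n ω‖ ≤ R n ω * ‖δ n ω‖) :
    TendstoInDistribution (fun (n : ℕ) ω => √(n : ℝ) • δ n ω) atTop
      (fun z => Matrix.toEuclideanCLM (𝕜 := ℝ) S⁻¹ (Z z)) (fun _ => μ) ν := by
  refine tendstoInDistribution_of_tendstoInMeasure_sub _ _
    (hψ.continuous_comp (Matrix.toEuclideanCLM (𝕜 := ℝ) S⁻¹).continuous)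
    (tendstoInMeasure_sqrt_smul_sub hdet hRm hR hR0 hψ hB h) fun n => ?_
  exact (hδm n).const_smul (√(n : ℝ))

/-- The quadratic approximation of the maximal value. -/
lemma tendstoInMeasure_value {Ω' : Type*} [MeasurableSpace Ω'] {ν : Measure Ω'}
    [IsProbabilityMeasure ν] {Z : Ω' → EuclideanSpace ℝ (Fin d)}
    {R : ℕ → Ω → ℝ} (hRm : ∀ n, AEMeasurable (R n) μ)
    (hR : TendstoInMeasure μ R atTop fun _ => 0)
    (hδ : TendstoInDistribution (fun (n : ℕ) ω => √(n : ℝ) • δ n ω) atTop Z (fun _ => μ) ν)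
    {B : ℕ → Set Ω} (hB : Tendsto (fun n => μ (B n)) atTop (𝓝 0)) {D a : ℕ → Ω → ℝ}
    (h : ∀ n, ∀ ω ∉ B n, |D n ω - a n ω - 2⁻¹ * ∑ k, ∑ j, S j k * δ n ω j * δ n ω k| ≤
      2 * R n ω * ‖δ n ω‖ ^ 2) :
    TendstoInMeasure μ (fun (n : ℕ) ω => n * (D n ω - a n ω) - 2⁻¹ * ∑ k, ∑ j,
      S j k * (√(n : ℝ) • δ n ω) j * (√(n : ℝ) • δ n ω) k) atTop fun _ => 0 := by
  refine tendstoInMeasure_zero_of_norm_le hB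
    (tendstoInMeasure_zero_mul hδ hR hRm (q := fun z => 2 * ‖z‖ ^ 2) (by fun_prop))
    fun n ω hω => ?_
  have hn : √(n : ℝ) * √(n : ℝ) = n := Real.mul_self_sqrt (Nat.cast_nonneg n)
  have e : ∀ j k, S j k * (√(n : ℝ) • δ n ω) j * (√(n : ℝ) • δ n ω) k =
      n * (S j k * δ n ω j * δ n ω k) := by
    intro j k
    simp only [PiLp.smul_apply, smul_eq_mul]
    linear_combination (S j k * δ n ω j * δ n ω k) * hn
  simp_rw [e, ← Finset.mul_sum]
  rw [norm_smul, Real.norm_eq_abs, Real.norm_eq_abs, abs_of_nonneg (Real.sqrt_nonneg _), mul_pow,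
    Real.sq_sqrt (Nat.cast_nonneg n), mul_left_comm (2⁻¹ : ℝ), ← mul_sub, abs_mul,
    abs_of_nonneg (Nat.cast_nonneg n)]
  refine (mul_le_mul_of_nonneg_left (h n ω hω) (Nat.cast_nonneg n)).trans (le_of_eq ?_)
  ring

lemma tendstoInDistribution_of_quadratic {Ω' : Type*} [MeasurableSpace Ω'] {ν : Measure Ω'}
    [IsProbabilityMeasure ν] {Y : ℕ → Ω → EuclideanSpace ℝ (Fin d)}
    {Z : Ω' → EuclideanSpace ℝ (Fin d)}
    (hY : TendstoInDistribution Y atTop Z (fun _ => μ) ν) {W : ℕ → Ω → ℝ}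
    (hWm : ∀ n, AEMeasurable (W n) μ) {q : EuclideanSpace ℝ (Fin d) → ℝ} (hq : Continuous q)
    (hW : TendstoInMeasure μ (fun n ω => W n ω - q (Y n ω)) atTop fun _ => 0) :
    TendstoInDistribution W atTop (fun z => q (Z z)) (fun _ => μ) ν :=
  tendstoInDistribution_of_tendstoInMeasure_sub _ _ (hY.continuous_comp hq) hW hWm

end Estimator

/-! ### Gaussian laws -/

section Gaussian

variable {d : ℕ}

lemma map_toEuclideanCLM_multivariateGaussian {M : Matrix (Fin d) (Fin d) ℝ}
    (hM : M.PosSemidef) (T : Matrix (Fin d) (Fin d) ℝ) :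
    (multivariateGaussian 0 M).map (Matrix.toEuclideanCLM (𝕜 := ℝ) T) =
      multivariateGaussian 0 (T * M * Tᵀ) := by
  have hpsd : (T * M * Tᵀ).PosSemidef := by
    simpa using hM.mul_mul_conjTranspose_same T
  refine Measure.ext_of_charFun ?_
  ext t
  rw [charFun_multivariateGaussian hpsd, charFun_apply,
    integral_map (by fun_prop) (by fun_prop)]
  have hinner : ∀ x, inner ℝ (Matrix.toEuclideanCLM (𝕜 := ℝ) T x) t =
      inner ℝ x (Matrix.toEuclideanCLM (𝕜 := ℝ) Tᵀ t) := by
    intro x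
    rw [real_inner_comm, Matrix.inner_toEuclideanCLM, Matrix.inner_toEuclideanCLM,
      Matrix.dotProduct_mulVec, ← Matrix.mulVec_transpose, dotProduct_comm]
  simp_rw [hinner]
  rw [← charFun_apply, charFun_multivariateGaussian hM]
  congr 2
  · simp
  · congr 2
    simp only [Matrix.ofLp_toEuclideanCLM]
    rw [← Matrix.mulVec_mulVec, ← Matrix.mulVec_mulVec, Matrix.dotProduct_mulVec t.ofLp T,
      ← Matrix.mulVec_transpose]

open scoped MatrixOrder in
lemma map_quadratic_multivariateGaussian {V A : Matrix (Fin d) (Fin d) ℝ} (hV : V.PosSemidef)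
    (hVA : V * A = 1) :
    (multivariateGaussian 0 V).map (fun z => ∑ k, ∑ j, A j k * z j * z k) = chiSquare d := by
  set Q := CFC.sqrt V with hQ
  have hQQ : Q * Q = V := CFC.sqrt_mul_sqrt_self _ hV.nonneg
  have hQs : Qᵀ = Q := by
    have := (CFC.sqrt_nonneg V).isSelfAdjoint.star_eq
    simpa [Matrix.star_eq_conjTranspose] using this
  have h1 : Q * A * Q = 1 := by
    rw [mul_eq_one_comm, ← Matrix.mul_assoc, hQQ, hVA]
  have hquad : ∀ z : EuclideanSpace ℝ (Fin d), ∑ k, ∑ j, A j k * z j * z k =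
      z.ofLp ⬝ᵥ A *ᵥ z.ofLp := by
    intro z
    rw [Finset.sum_comm]
    simp only [dotProduct, Matrix.mulVec, Finset.mul_sum]
    exact Finset.sum_congr rfl fun i _ => Finset.sum_congr rfl fun j _ => by ring
  simp_rw [hquad]
  rw [multivariateGaussian, Measure.map_map (by fun_prop) (by fun_prop), ← map_pi_eq_stdGaussian,
    Measure.map_map (by fun_prop) (by fun_prop), chiSquare]
  congr 1
  ext z
  simp only [Function.comp_apply, zero_add, Matrix.ofLp_toEuclideanCLM]
  have h2 : Q *ᵥ z = z ᵥ* Q := by rw [← Matrix.vecMul_transpose, hQs]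
  nth_rewrite 1 [h2]
  rw [← Matrix.dotProduct_mulVec, Matrix.mulVec_mulVec, Matrix.mulVec_mulVec, ← hQ,
    h1, Matrix.one_mulVec]
  simp [dotProduct, sq]

end Gaussian

/-! ### Expansion of an empirical criterion at its maximizer -/

section Criterion

variable {𝒳 Ω : Type*} (X : ℕ → Ω → 𝒳) (n : ℕ) (ω : Ω)

lemma empMean_sub (u v : 𝒳 → ℝ) :
    empMean X n (fun x => u x - v x) ω = empMean X n u ω - empMean X n v ω := by
  simp [empMean, mul_sub]

lemma empMean_const_mul (c : ℝ) (u : 𝒳 → ℝ) :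
    empMean X n (fun x => c * u x) ω = c * empMean X n u ω := by
  simp only [empMean, ← Finset.mul_sum]
  ring

lemma empMean_mul_const (c : ℝ) (u : 𝒳 → ℝ) :
    empMean X n (fun x => u x * c) ω = empMean X n u ω * c := by
  simp_rw [mul_comm _ c]
  exact empMean_const_mul X n ω c u

lemma empMean_sum {κ : Type*} (s : Finset κ) (u : κ → 𝒳 → ℝ) :
    empMean X n (fun x => ∑ k ∈ s, u k x) ω = ∑ k ∈ s, empMean X n (u k) ω := by
  simp only [empMean, Finset.mul_sum]
  rw [Finset.sum_comm]

variable {X n ω}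

lemma abs_empMean_le {u v : 𝒳 → ℝ} (h : ∀ i, |u (X i ω)| ≤ v (X i ω)) :
    |empMean X n u ω| ≤ empMean X n v ω := by
  unfold empMean
  rw [abs_mul, abs_of_nonneg (by positivity)]
  gcongr
  exact (Finset.abs_sum_le_sum_abs _ _).trans (Finset.sum_le_sum fun i _ => h i)

variable {d : ℕ}

lemma hasLineDerivAt_empMean {m : EuclideanSpace ℝ (Fin d) → 𝒳 → ℝ}
    {α v : EuclideanSpace ℝ (Fin d)}
    (h : ∀ i, LineDifferentiableAt ℝ (fun a => m a (X i ω)) α v) :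
    HasLineDerivAt ℝ (fun a => empMean X n (m a) ω)
      (empMean X n (fun x => lineDeriv ℝ (fun a => m a x) α v) ω) α v :=
  HasDerivAt.const_mul _ (HasDerivAt.fun_sum fun i _ => (h i).hasLineDerivAt)

variable [MeasurableSpace 𝒳] [MeasurableSpace Ω] {P : Measure 𝒳} {μ : Measure Ω}

/-- A second order expansion of `m` at `θT`, with remainders controlled by `F`. -/
structure HasExpansion (m : EuclideanSpace ℝ (Fin d) → 𝒳 → ℝ) (θT : EuclideanSpace ℝ (Fin d))
    (r : ℝ) (F : 𝒳 → ℝ) (x : 𝒳) : Prop where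
  lineDifferentiableAt : ∀ α ∈ Metric.ball θT r, ∀ k,
    LineDifferentiableAt ℝ (fun a => m a x) α (EuclideanSpace.single k 1)
  gradient : ∀ α ∈ Metric.ball θT r, ∀ k, |pderiv k (fun a => m a x) α -
    pderiv k (fun a => m a x) θT - ∑ j, pderiv j (pderiv k fun a => m a x) θT * (α j - θT j)| ≤
      d ^ 2 * F x * ‖α - θT‖ ^ 2
  value : ∀ α ∈ Metric.ball θT r, |m α x - m θT x -
    ∑ k, pderiv k (fun a => m a x) θT * (α k - θT k) -
    2⁻¹ * ∑ k, ∑ j, pderiv j (pderiv k fun a => m a x) θT * (α j - θT j) * (α k - θT k)| ≤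
      d ^ 3 * F x * ‖α - θT‖ ^ 3

/-- The expansions of the empirical criterion and of its gradient at a consistent maximizer. -/
lemma exists_expansion_empMean {m : EuclideanSpace ℝ (Fin d) → 𝒳 → ℝ}
    {θT : EuclideanSpace ℝ (Fin d)} {r : ℝ} (hr : 0 < r) {F : 𝒳 → ℝ}
    (hexp : ∀ᵐ x ∂P, HasExpansion m θT r F x) (hlaw : ∀ i, HasLaw (X i) P μ)
    {Θ : Set (EuclideanSpace ℝ (Fin d))} (hΘ : Metric.ball θT r ⊆ Θ)
    {αhat : ℕ → Ω → EuclideanSpace ℝ (Fin d)}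
    (hmax : Tendsto (fun n => μ {ω | ¬ (αhat n ω ∈ Θ ∧
      IsMaxOn (fun α => empMean X n (m α) ω) Θ (αhat n ω))}) atTop (𝓝 0))
    (hcons : TendstoInMeasure μ αhat atTop fun _ => θT) :
    ∃ B : ℕ → Set Ω, Tendsto (fun n => μ (B n)) atTop (𝓝 0) ∧ ∀ n, ∀ ω ∉ B n,
      (αhat n ω ∈ Θ ∧ IsMaxOn (fun α => empMean X n (m α) ω) Θ (αhat n ω)) ∧
      (∀ k, |empMean X n (fun x => pderiv k (fun a => m a x) θT) ω +
        ∑ j, empMean X n (fun x => pderiv j (pderiv k fun a => m a x) θT) ω *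
          (αhat n ω - θT) j| ≤ d ^ 2 * empMean X n F ω * ‖αhat n ω - θT‖ ^ 2) ∧
      |empMean X n (m (αhat n ω)) ω - empMean X n (m θT) ω -
        ∑ k, empMean X n (fun x => pderiv k (fun a => m a x) θT) ω * (αhat n ω - θT) k -
        2⁻¹ * ∑ k, ∑ j, empMean X n (fun x => pderiv j (pderiv k fun a => m a x) θT) ω *
          (αhat n ω - θT) j * (αhat n ω - θT) k| ≤
        d ^ 3 * empMean X n F ω * ‖αhat n ω - θT‖ ^ 3 := by
  have hnull : Tendsto (fun _ : ℕ => μ {ω | ¬ ∀ i, HasExpansion m θT r F (X i ω)}) atTop (𝓝 0) := by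
    rw [ae_iff.1 (ae_forall_comp_of_hasLaw hlaw hexp)]
    exact tendsto_const_nhds
  refine ⟨_, tendsto_measure_union_zero (tendsto_measure_union_zero hmax
    (tendsto_measure_le_norm (tendstoInMeasure_sub_const hcons) hr)) hnull, fun n ω hω => ?_⟩
  simp only [Set.mem_union, Set.mem_ofPred_eq, not_or, not_le, not_not] at hω
  obtain ⟨⟨hω1, hω2⟩, hω3⟩ := hω
  have hball : αhat n ω ∈ Metric.ball θT r := mem_ball_iff_norm.2 hω2
  refine ⟨hω1, fun k => ?_, ?_⟩
  · have h0 : empMean X n (fun x => pderiv k (fun a => m a x) (αhat n ω)) ω = 0 := by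
      have h1 := pderiv_eq_zero_of_isLocalMax (hω1.2.isLocalMax
        (Filter.mem_of_superset (Metric.isOpen_ball.mem_nhds hball) hΘ)) k
      rwa [pderiv, (hasLineDerivAt_empMean fun i =>
        (hω3 i).lineDifferentiableAt _ hball k).lineDeriv] at h1
    have h2 := abs_empMean_le (X := X) (n := n) (ω := ω)
      (u := fun x => pderiv k (fun a => m a x) (αhat n ω) - pderiv k (fun a => m a x) θT -
        ∑ j, pderiv j (pderiv k fun a => m a x) θT * (αhat n ω j - θT j))
      (v := fun x => d ^ 2 * F x * ‖αhat n ω - θT‖ ^ 2)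
      fun i => (hω3 i).gradient _ hball k
    rw [empMean_sub, empMean_sub, empMean_sum, h0, empMean_mul_const, empMean_const_mul] at h2
    simp_rw [empMean_mul_const] at h2
    rw [zero_sub, ← neg_add', abs_neg] at h2
    exact h2
  · have h2 := abs_empMean_le (X := X) (n := n) (ω := ω)
      (u := fun x => m (αhat n ω) x - m θT x -
        ∑ k, pderiv k (fun a => m a x) θT * (αhat n ω k - θT k) -
        2⁻¹ * ∑ k, ∑ j, pderiv j (pderiv k fun a => m a x) θT * (αhat n ω j - θT j) *
          (αhat n ω k - θT k))
      (v := fun x => d ^ 3 * F x * ‖αhat n ω - θT‖ ^ 3)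
      fun i => (hω3 i).value _ hball
    rw [empMean_sub, empMean_sub, empMean_sub, empMean_sum, empMean_const_mul, empMean_sum,
      empMean_mul_const, empMean_const_mul] at h2
    simp_rw [empMean_sum, empMean_mul_const] at h2
    exact h2

end Criterion

/-! ### The divergence function -/

section DivergenceFunction

variable {φ : ℝ → ℝ≥0∞} (hφ : IsDivergenceFunction φ)

include hφ

lemma measurable_re : Measurable (re φ) :=
  hφ.closed.measurable.ennreal_toReal

lemma re_one : re φ 1 = 0 := by
  simp [re, hφ.map_one]

lemma contDiffOn_deriv_re : ContDiffOn ℝ 3 (deriv (re φ)) (interior (dom φ)) :=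
  hφ.contDiff.deriv_of_isOpen isOpen_interior (by norm_num)

lemma hasDerivAt_re {y : ℝ} (hy : y ∈ interior (dom φ)) :
    HasDerivAt (re φ) (deriv (re φ) y) y :=
  ((hφ.contDiff.contDiffAt (isOpen_interior.mem_nhds hy)).differentiableAt (by norm_num)).hasDerivAt

lemma hasDerivAt_deriv_re {y : ℝ} (hy : y ∈ interior (dom φ)) :
    HasDerivAt (deriv (re φ)) (deriv (deriv (re φ)) y) y :=
  (((contDiffOn_deriv_re hφ).contDiffAt (isOpen_interior.mem_nhds hy)).differentiableAt
    (by norm_num)).hasDerivAt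

end DivergenceFunction

/-! ### Measures of the model -/

section Model

variable {𝒳 : Type*} [MeasurableSpace 𝒳] {d : ℕ} {lam : Measure 𝒳}
  {Θ : Set (EuclideanSpace ℝ (Fin d))} {p : EuclideanSpace ℝ (Fin d) → 𝒳 → ℝ}
  (hmodel : IsRegularModel lam Θ p)

include hmodel

lemma ae_modelMeasure_iff {α : EuclideanSpace ℝ (Fin d)} (hα : α ∈ Θ) {q : 𝒳 → Prop} :
    (∀ᵐ x ∂modelMeasure lam p α, q x) ↔ ∀ᵐ x ∂lam, 0 < p α x → q x := by
  rw [modelMeasure, ae_withDensity_iff (hmodel.measurable α hα).ennreal_ofReal]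
  simp

lemma integrable_modelMeasure_iff {α : EuclideanSpace ℝ (Fin d)} (hα : α ∈ Θ) {u : 𝒳 → ℝ} :
    Integrable u (modelMeasure lam p α) ↔ Integrable (fun x => p α x * u x) lam := by
  rw [modelMeasure, integrable_withDensity_iff (hmodel.measurable α hα).ennreal_ofReal (by simp)]
  simp_rw [ENNReal.toReal_ofReal (hmodel.nonneg α hα _), mul_comm]

lemma integral_modelMeasure {α : EuclideanSpace ℝ (Fin d)} (hα : α ∈ Θ) (u : 𝒳 → ℝ) :
    ∫ x, u x ∂modelMeasure lam p α = ∫ x, p α x * u x ∂lam := by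
  rw [modelMeasure, integral_withDensity_eq_integral_toReal_smul
    (hmodel.measurable α hα).ennreal_ofReal (by simp)]
  simp_rw [ENNReal.toReal_ofReal (hmodel.nonneg α hα _), smul_eq_mul]

end Model

/-! ### Differentiation under the integral sign -/

section Integral

variable {𝒳 : Type*} [MeasurableSpace 𝒳] {d : ℕ} {lam : Measure 𝒳}

lemma aestronglyMeasurable_pderiv {u : EuclideanSpace ℝ (Fin d) → 𝒳 → ℝ}
    {N : Set (EuclideanSpace ℝ (Fin d))} (hN : IsOpen N) (i : Fin d)
    (hm : ∀ α ∈ N, AEStronglyMeasurable (u α) lam) {α : EuclideanSpace ℝ (Fin d)} (hα : α ∈ N)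
    (hd : ∀ᵐ x ∂lam, LineDifferentiableAt ℝ (fun a => u a x) α (EuclideanSpace.single i 1)) :
    AEStronglyMeasurable (fun x => pderiv i (fun a => u a x) α) lam := by
  set e : EuclideanSpace ℝ (Fin d) := EuclideanSpace.single i 1
  have hc : Tendsto (fun t : ℝ => α + t • e) (𝓝[>] 0) (𝓝 α) := by
    have : ContinuousAt (fun t : ℝ => α + t • e) 0 := by fun_prop
    simpa using this.tendsto.mono_left nhdsWithin_le_nhds
  obtain ⟨s, hs⟩ := (𝓝[>] (0 : ℝ)).exists_seq_tendsto
  have hev : ∀ᶠ n in atTop, α + s n • e ∈ N := hs (hc (hN.mem_nhds hα))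
  obtain ⟨k, hk⟩ := eventually_atTop.1 hev
  refine aestronglyMeasurable_of_tendsto_ae atTop
    (f := fun n x => (s (n + k))⁻¹ • (u (α + s (n + k) • e) x - u α x)) (fun n => ?_) ?_
  · exact ((hm _ (hk _ (Nat.le_add_left k n))).sub (hm α hα)).const_smul (s (n + k))⁻¹
  · filter_upwards [hd] with x hx
    exact hx.hasLineDerivAt.tendsto_slope_zero_right.comp (hs.comp (tendsto_add_atTop_nat k))

/-- Differentiation under the integral sign, for partial derivatives. -/
lemma hasLineDerivAt_integral {u : EuclideanSpace ℝ (Fin d) → 𝒳 → ℝ}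
    {N : Set (EuclideanSpace ℝ (Fin d))} (hN : IsOpen N) (i : Fin d)
    (hint : ∀ α ∈ N, Integrable (u α) lam)
    (hd : ∀ᵐ x ∂lam, ∀ α ∈ N,
      LineDifferentiableAt ℝ (fun a => u a x) α (EuclideanSpace.single i 1))
    (hb : ∃ F : 𝒳 → ℝ, Integrable F lam ∧ ∀ᵐ x ∂lam, ∀ α ∈ N, |pderiv i (fun a => u a x) α| ≤ F x)
    {α : EuclideanSpace ℝ (Fin d)} (hα : α ∈ N) :
    Integrable (fun x => pderiv i (fun a => u a x) α) lam ∧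
      HasLineDerivAt ℝ (fun a => ∫ x, u a x ∂lam) (∫ x, pderiv i (fun a => u a x) α ∂lam) α
        (EuclideanSpace.single i 1) := by
  obtain ⟨F, hF, hFb⟩ := hb
  set e : EuclideanSpace ℝ (Fin d) := EuclideanSpace.single i 1 with he
  have hc : ContinuousAt (fun t : ℝ => α + t • e) 0 := by fun_prop
  have h0 : α + (0 : ℝ) • e = α := by simp
  have hs : {t : ℝ | α + t • e ∈ N} ∈ 𝓝 (0 : ℝ) :=
    hc.preimage_mem_nhds (by rw [h0]; exact hN.mem_nhds hα)
  have := hasDerivAt_integral_of_dominated_loc_of_deriv_le (μ := lam) (x₀ := (0 : ℝ))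
    (F := fun t x => u (α + t • e) x)
    (F' := fun t x => pderiv i (fun a => u a x) (α + t • e)) (bound := F) hs
    (Filter.mem_of_superset hs fun t ht => (hint _ ht).aestronglyMeasurable)
    (by rw [h0]; exact hint α hα)
    (by
      rw [h0]
      exact aestronglyMeasurable_pderiv hN i (fun β hβ => (hint β hβ).aestronglyMeasurable) hα
        (hd.mono fun x hx => hx α hα))
    (hFb.mono fun x hx t ht => hx _ ht) hF
    (hd.mono fun x hx t ht => hasDerivAt_line (hx _ ht))
  rw [h0] at this
  exact this

end Integral

/-! ### The functions `f`, `g` and `h` at a regular point -/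

section Pointwise

variable {𝒳 : Type*} {d : ℕ} {φ : ℝ → ℝ≥0∞}
  {Θ : Set (EuclideanSpace ℝ (Fin d))} {p : EuclideanSpace ℝ (Fin d) → 𝒳 → ℝ}
  {θ : EuclideanSpace ℝ (Fin d)} {x : 𝒳}

/-- Points of the common support where the densities are smooth in the parameter and the functions
`f` and `g` are well defined. -/
structure IsRegularPoint (φ : ℝ → ℝ≥0∞) (Θ : Set (EuclideanSpace ℝ (Fin d)))
    (p : EuclideanSpace ℝ (Fin d) → 𝒳 → ℝ) (θ : EuclideanSpace ℝ (Fin d)) (x : 𝒳) : Prop where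
  pos : ∀ α ∈ Θ, 0 < p α x
  contDiffOn : ContDiffOn ℝ 3 (fun a => p a x) (interior Θ)
  ratio_mem : ∀ α ∈ Θ, p θ x / p α x ∈ interior (dom φ)

variable (hφ : IsDivergenceFunction φ) (hx : IsRegularPoint φ Θ p θ x)

include hx

lemma contDiffOn_ratio : ContDiffOn ℝ 3 (fun a => p θ x / p a x) (interior Θ) :=
  contDiffOn_const.div hx.contDiffOn fun α hα => (hx.pos α (interior_subset hα)).ne'

include hφ

lemma contDiffOn_f : ContDiffOn ℝ 3 (fun a => f φ p θ a x) (interior Θ) :=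
  (contDiffOn_deriv_re hφ).comp (contDiffOn_ratio hx) fun α hα =>
    hx.ratio_mem α (interior_subset hα)

lemma contDiffOn_g : ContDiffOn ℝ 3 (fun a => g φ p θ a x) (interior Θ) :=
  ((contDiffOn_ratio hx).mul (contDiffOn_f hφ hx)).sub
    ((hφ.contDiff.of_le (by norm_num)).comp (contDiffOn_ratio hx)
      fun α hα => hx.ratio_mem α (interior_subset hα))

lemma hasLineDerivAt_f {α : EuclideanSpace ℝ (Fin d)} (hα : α ∈ interior Θ) (i : Fin d) :
    HasLineDerivAt ℝ (fun a => f φ p θ a x)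
      (deriv (deriv (re φ)) (p θ x / p α x) * pderiv i (fun a => p θ x / p a x) α) α
      (EuclideanSpace.single i 1) := by
  have hr := (lineDifferentiableAt_of_contDiffOn (by norm_num) (contDiffOn_ratio hx)
    isOpen_interior hα (EuclideanSpace.single i 1)).hasLineDerivAt
  exact HasDerivAt.comp (h₂ := deriv (re φ)) (0 : ℝ)
    (by simpa using hasDerivAt_deriv_re hφ (hx.ratio_mem α (interior_subset hα))) hr

lemma hasLineDerivAt_g {α : EuclideanSpace ℝ (Fin d)} (hα : α ∈ interior Θ) (i : Fin d) :
    HasLineDerivAt ℝ (fun a => g φ p θ a x)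
      (p θ x / p α x * deriv (deriv (re φ)) (p θ x / p α x) *
        pderiv i (fun a => p θ x / p a x) α) α (EuclideanSpace.single i 1) := by
  have hr := (lineDifferentiableAt_of_contDiffOn (by norm_num) (contDiffOn_ratio hx)
    isOpen_interior hα (EuclideanSpace.single i 1)).hasLineDerivAt
  have hy := hx.ratio_mem α (interior_subset hα)
  have hG : HasDerivAt (fun y => y * deriv (re φ) y - re φ y)
      (p θ x / p α x * deriv (deriv (re φ)) (p θ x / p α x)) (p θ x / p α x) := by
    have := ((hasDerivAt_id _).mul (hasDerivAt_deriv_re hφ hy)).sub (hasDerivAt_re hφ hy)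
    refine this.congr_deriv ?_
    simp
  exact HasDerivAt.comp (h₂ := fun y => y * deriv (re φ) y - re φ y) (0 : ℝ)
    (by simpa using hG) hr

lemma mul_pderiv_g {α : EuclideanSpace ℝ (Fin d)} (hα : α ∈ interior Θ) (i : Fin d) :
    p α x * pderiv i (fun a => g φ p θ a x) α = p θ x * pderiv i (fun a => f φ p θ a x) α := by
  have hp := (hx.pos α (interior_subset hα)).ne'
  rw [pderiv, pderiv, (hasLineDerivAt_g hφ hx hα i).lineDeriv,
    (hasLineDerivAt_f hφ hx hα i).lineDeriv]
  field_simp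

lemma pderiv_f_mul {α : EuclideanSpace ℝ (Fin d)} (hα : α ∈ interior Θ) (i : Fin d) :
    pderiv i (fun a => f φ p θ a x * p θ x) α = p α x * pderiv i (fun a => g φ p θ a x) α := by
  rw [mul_pderiv_g hφ hx hα, mul_comm]
  exact (HasDerivAt.mul_const (lineDifferentiableAt_of_contDiffOn (by norm_num)
    (contDiffOn_f hφ hx) isOpen_interior hα _).hasLineDerivAt _).deriv

lemma pderiv_pderiv_f_mul {α : EuclideanSpace ℝ (Fin d)} (hα : α ∈ interior Θ) (i j : Fin d) :
    pderiv i (pderiv j fun a => f φ p θ a x * p θ x) α =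
      pderiv i (fun a => p a x) α * pderiv j (fun a => g φ p θ a x) α +
        p α x * pderiv i (pderiv j fun a => g φ p θ a x) α := by
  rw [pderiv_congr_of_eqOn isOpen_interior (fun β hβ => pderiv_f_mul hφ hx hβ j) hα]
  have h1 := (lineDifferentiableAt_of_contDiffOn (by norm_num) hx.contDiffOn
    isOpen_interior hα (EuclideanSpace.single i 1)).hasLineDerivAt
  have h2 := (lineDifferentiableAt_of_contDiffOn (n := 2) (by norm_num)
    (contDiffOn_pderiv ((contDiffOn_g hφ hx).of_le (by norm_num)) isOpen_interior j)
    isOpen_interior hα (EuclideanSpace.single i 1)).hasLineDerivAt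
  have := (HasDerivAt.fun_mul h1 h2).deriv
  simpa [pderiv, lineDeriv] using this

omit hx
lemma pderiv_g_self (hx : IsRegularPoint φ Θ p θ x) (hθ : θ ∈ interior Θ) (i : Fin d) :
    pderiv i (fun a => g φ p θ a x) θ =
      -deriv (deriv (re φ)) 1 * (pderiv i (fun a => p a x) θ / p θ x) := by
  have hp := (hx.pos θ (interior_subset hθ)).ne'
  rw [pderiv, (hasLineDerivAt_g hφ hx hθ i).lineDeriv, div_self hp]
  have h1 := (lineDifferentiableAt_of_contDiffOn (by norm_num) hx.contDiffOn
    isOpen_interior hθ (EuclideanSpace.single i 1)).hasLineDerivAt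
  have h2 : pderiv i (fun a => p θ x / p a x) θ = -(pderiv i (fun a => p a x) θ / p θ x) := by
    have := (HasDerivAt.div (hasDerivAt_const (0 : ℝ) (p θ x)) h1 (by simpa using hp)).deriv
    rw [pderiv, lineDeriv]
    refine this.trans ?_
    simp only [zero_smul, add_zero, zero_mul, zero_sub]
    rw [pderiv]
    field_simp
  rw [h2]
  ring

end Pointwise

/-! ### Regularity of the criterion function `h` -/

section Regularity

variable {𝒳 : Type*} [MeasurableSpace 𝒳] {d : ℕ} {φ : ℝ → ℝ≥0∞} {lam : Measure 𝒳}
  {Θ : Set (EuclideanSpace ℝ (Fin d))} {p : EuclideanSpace ℝ (Fin d) → 𝒳 → ℝ}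
  {θ θT : EuclideanSpace ℝ (Fin d)}

lemma ae_isRegularPoint (hmodel : IsRegularModel lam Θ p) (hθ : θ ∈ Θ)
    (hint : DualIntegrable φ lam Θ p θ) :
    ∀ᵐ x ∂lam, ∀ α ∈ Θ, 0 < p α x → IsRegularPoint φ Θ p θ x := by
  filter_upwards [hmodel.support_eq, hmodel.contDiff,
    (ae_modelMeasure_iff hmodel hθ).1 hint.1] with x h1 h2 h3 α hα hpos
  exact ⟨fun β hβ => (h1 α hα β hβ).1 hpos, h2, h3 ((h1 α hα θ hθ).1 hpos)⟩

lemma ae_modelMeasure_isRegularPoint (hmodel : IsRegularModel lam Θ p) (hθ : θ ∈ Θ)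
    (hint : DualIntegrable φ lam Θ p θ) {α : EuclideanSpace ℝ (Fin d)} (hα : α ∈ Θ) :
    ∀ᵐ x ∂modelMeasure lam p α, IsRegularPoint φ Θ p θ x := by
  rw [ae_modelMeasure_iff hmodel hα]
  filter_upwards [ae_isRegularPoint hmodel hθ hint] with x hx using hx α hα

lemma ae_contDiffOn_f_mul (hφ : IsDivergenceFunction φ) (hmodel : IsRegularModel lam Θ p)
    (hθ : θ ∈ Θ) (hint : DualIntegrable φ lam Θ p θ) :
    ∀ᵐ x ∂lam, ContDiffOn ℝ 3 (fun a => f φ p θ a x * p θ x) (interior Θ) := by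
  filter_upwards [ae_isRegularPoint hmodel hθ hint] with x hx
  rcases (hmodel.nonneg θ hθ x).eq_or_lt with h | h
  · simp only [← h, mul_zero]
    exact contDiffOn_const
  · exact (contDiffOn_f hφ (hx θ hθ h)).mul contDiffOn_const

lemma integrable_f_mul (hmodel : IsRegularModel lam Θ p) (hθ : θ ∈ Θ)
    (hint : DualIntegrable φ lam Θ p θ) {α : EuclideanSpace ℝ (Fin d)} (hα : α ∈ Θ) :
    Integrable (fun x => f φ p θ α x * p θ x) lam := by
  simpa only [mul_comm] using (integrable_modelMeasure_iff hmodel hθ).1 (hint.2 α hα)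

/-- The function `α ↦ P_θ f(θ, α)`. -/
def meanF (φ : ℝ → ℝ≥0∞) (lam : Measure 𝒳) (p : EuclideanSpace ℝ (Fin d) → 𝒳 → ℝ)
    (θ α : EuclideanSpace ℝ (Fin d)) : ℝ :=
  ∫ y, f φ p θ α y ∂modelMeasure lam p θ

lemma h_eq (α : EuclideanSpace ℝ (Fin d)) (x : 𝒳) :
    h φ lam p θ α x = meanF φ lam p θ α - g φ p θ α x := rfl

lemma meanF_eq (hmodel : IsRegularModel lam Θ p) (hθ : θ ∈ Θ) (α : EuclideanSpace ℝ (Fin d)) :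
    meanF φ lam p θ α = ∫ x, f φ p θ α x * p θ x ∂lam := by
  rw [meanF, integral_modelMeasure hmodel hθ]
  simp_rw [mul_comm]

/-- Domination of the first and second order partial derivatives of `f p_θ` on `N`. -/
structure IsDominatedOn (φ : ℝ → ℝ≥0∞) (lam : Measure 𝒳) (Θ : Set (EuclideanSpace ℝ (Fin d)))
    (p : EuclideanSpace ℝ (Fin d) → 𝒳 → ℝ) (θ : EuclideanSpace ℝ (Fin d))
    (N : Set (EuclideanSpace ℝ (Fin d))) : Prop where
  isOpen : IsOpen N
  subset : N ⊆ Θ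
  first : ∀ i, ∃ F : 𝒳 → ℝ, Integrable F lam ∧ ∀ᵐ x ∂lam, ∀ α ∈ N,
      |pderiv i (fun a => f φ p θ a x * p θ x) α| ≤ F x
  second : ∀ i j, ∃ F : 𝒳 → ℝ, Integrable F lam ∧ ∀ᵐ x ∂lam, ∀ α ∈ N,
      |pderiv i (pderiv j fun a => f φ p θ a x * p θ x) α| ≤ F x

variable {N : Set (EuclideanSpace ℝ (Fin d))} (hφ : IsDivergenceFunction φ)
  (hmodel : IsRegularModel lam Θ p) (hθ : θ ∈ Θ) (hint : DualIntegrable φ lam Θ p θ)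
  (hN : IsDominatedOn φ lam Θ p θ N)

lemma IsDominatedOn.mem_interior (hN : IsDominatedOn φ lam Θ p θ N)
    {α : EuclideanSpace ℝ (Fin d)} (hα : α ∈ N) : α ∈ interior Θ :=
  interior_maximal hN.subset hN.isOpen hα

include hφ hmodel hθ hint hN

lemma hasLineDerivAt_meanF {α : EuclideanSpace ℝ (Fin d)} (hα : α ∈ N) (i : Fin d) :
    Integrable (fun x => pderiv i (fun a => f φ p θ a x * p θ x) α) lam ∧
      HasLineDerivAt ℝ (meanF φ lam p θ)
        (∫ x, pderiv i (fun a => f φ p θ a x * p θ x) α ∂lam) α (EuclideanSpace.single i 1) := by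
  have := hasLineDerivAt_integral (u := fun a x => f φ p θ a x * p θ x) hN.isOpen i
    (fun β hβ => integrable_f_mul hmodel hθ hint (hN.subset hβ))
    ((ae_contDiffOn_f_mul hφ hmodel hθ hint).mono fun x hx β hβ =>
      lineDifferentiableAt_of_contDiffOn (by norm_num) hx isOpen_interior (hN.mem_interior hβ) _)
    (hN.first i) hα
  rw [show meanF φ lam p θ = fun a => ∫ x, f φ p θ a x * p θ x ∂lam from
    funext fun a => meanF_eq hmodel hθ a]
  exact this

lemma hasLineDerivAt_pderiv_meanF {α : EuclideanSpace ℝ (Fin d)} (hα : α ∈ N) (i j : Fin d) :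
    Integrable (fun x => pderiv i (pderiv j fun a => f φ p θ a x * p θ x) α) lam ∧
      HasLineDerivAt ℝ (pderiv j (meanF φ lam p θ))
        (∫ x, pderiv i (pderiv j fun a => f φ p θ a x * p θ x) α ∂lam) α
        (EuclideanSpace.single i 1) := by
  have := hasLineDerivAt_integral (u := fun a x => pderiv j (fun a => f φ p θ a x * p θ x) a)
    hN.isOpen i
    (fun β hβ => (hasLineDerivAt_meanF hφ hmodel hθ hint hN hβ j).1)
    ((ae_contDiffOn_f_mul hφ hmodel hθ hint).mono fun x hx β hβ =>
      lineDifferentiableAt_of_contDiffOn (n := 2) (by norm_num)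
        (contDiffOn_pderiv (hx.of_le (by norm_num)) isOpen_interior j) isOpen_interior
        (hN.mem_interior hβ) _)
    (hN.second i j) hα
  refine ⟨this.1, this.2.congr_of_eventuallyEq ?_⟩
  filter_upwards [hN.isOpen.mem_nhds hα] with β hβ
  exact (hasLineDerivAt_meanF hφ hmodel hθ hint hN hβ j).2.lineDeriv

lemma pderiv_pderiv_meanF_comm {α : EuclideanSpace ℝ (Fin d)} (hα : α ∈ N) (i j : Fin d) :
    pderiv i (pderiv j (meanF φ lam p θ)) α = pderiv j (pderiv i (meanF φ lam p θ)) α := by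
  refine ((hasLineDerivAt_pderiv_meanF hφ hmodel hθ hint hN hα i j).2.lineDeriv.trans ?_).trans
    (hasLineDerivAt_pderiv_meanF hφ hmodel hθ hint hN hα j i).2.lineDeriv.symm
  refine integral_congr_ae ?_
  filter_upwards [ae_contDiffOn_f_mul hφ hmodel hθ hint] with x hx
  exact pderiv_pderiv_comm (hx.of_le (by norm_num)) isOpen_interior (hN.mem_interior hα) i j

variable {x : 𝒳} (hx : IsRegularPoint φ Θ p θ x)

include hx

lemma hasLineDerivAt_h {α : EuclideanSpace ℝ (Fin d)} (hα : α ∈ N) (i : Fin d) :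
    HasLineDerivAt ℝ (fun a => h φ lam p θ a x)
      (pderiv i (meanF φ lam p θ) α - pderiv i (fun a => g φ p θ a x) α) α
      (EuclideanSpace.single i 1) :=
  HasDerivAt.sub
    (hasLineDerivAt_meanF hφ hmodel hθ hint hN hα i).2.lineDifferentiableAt.hasLineDerivAt
    (lineDifferentiableAt_of_contDiffOn (by norm_num) (contDiffOn_g hφ hx) isOpen_interior
      (hN.mem_interior hα) _).hasLineDerivAt

lemma pderiv_h {α : EuclideanSpace ℝ (Fin d)} (hα : α ∈ N) (i : Fin d) :
    pderiv i (fun a => h φ lam p θ a x) α =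
      pderiv i (meanF φ lam p θ) α - pderiv i (fun a => g φ p θ a x) α :=
  (hasLineDerivAt_h hφ hmodel hθ hint hN hx hα i).lineDeriv

lemma hasLineDerivAt_pderiv_h {α : EuclideanSpace ℝ (Fin d)} (hα : α ∈ N) (i j : Fin d) :
    HasLineDerivAt ℝ (pderiv j fun a => h φ lam p θ a x)
      (pderiv i (pderiv j (meanF φ lam p θ)) α - pderiv i (pderiv j fun a => g φ p θ a x) α) α
      (EuclideanSpace.single i 1) := by
  refine HasLineDerivAt.congr_of_eventuallyEq (f := fun a => pderiv j (meanF φ lam p θ) a -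
    pderiv j (fun a => g φ p θ a x) a) ?_ ?_
  · exact HasDerivAt.sub
      (hasLineDerivAt_pderiv_meanF hφ hmodel hθ hint hN hα i
        j).2.lineDifferentiableAt.hasLineDerivAt
      (lineDifferentiableAt_of_contDiffOn (n := 2) (by norm_num)
        (contDiffOn_pderiv ((contDiffOn_g hφ hx).of_le (by norm_num)) isOpen_interior j)
        isOpen_interior (hN.mem_interior hα) _).hasLineDerivAt
  · filter_upwards [hN.isOpen.mem_nhds hα] with β hβ
    exact pderiv_h hφ hmodel hθ hint hN hx hβ j

lemma pderiv_pderiv_h {α : EuclideanSpace ℝ (Fin d)} (hα : α ∈ N) (i j : Fin d) :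
    pderiv i (pderiv j fun a => h φ lam p θ a x) α =
      pderiv i (pderiv j (meanF φ lam p θ)) α - pderiv i (pderiv j fun a => g φ p θ a x) α :=
  (hasLineDerivAt_pderiv_h hφ hmodel hθ hint hN hx hα i j).lineDeriv

lemma pderiv_pderiv_h_comm {α : EuclideanSpace ℝ (Fin d)} (hα : α ∈ N) (i j : Fin d) :
    pderiv i (pderiv j fun a => h φ lam p θ a x) α =
      pderiv j (pderiv i fun a => h φ lam p θ a x) α := by
  rw [pderiv_pderiv_h hφ hmodel hθ hint hN hx hα, pderiv_pderiv_h hφ hmodel hθ hint hN hx hα,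
    pderiv_pderiv_meanF_comm hφ hmodel hθ hint hN hα,
    pderiv_pderiv_comm ((contDiffOn_g hφ hx).of_le (by norm_num)) isOpen_interior
      (hN.mem_interior hα)]

omit hx

/-- The function `h` has a second order expansion at `θT` with an integrable remainder. -/
lemma exists_hasExpansion (hθT : θT ∈ N)
    (h3 : ∀ i j k, ∃ F : 𝒳 → ℝ, Integrable F (modelMeasure lam p θT) ∧
      ∀ᵐ x ∂(modelMeasure lam p θT), ∀ α ∈ N,
        LineDifferentiableAt ℝ (pderiv j (pderiv k fun a => h φ lam p θ a x)) α
          (EuclideanSpace.single i 1) ∧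
        |pderiv i (pderiv j (pderiv k fun a => h φ lam p θ a x)) α| ≤ F x) :
    ∃ r > 0, Metric.ball θT r ⊆ Θ ∧ ∃ F : 𝒳 → ℝ, Integrable F (modelMeasure lam p θT) ∧
      ∀ᵐ x ∂modelMeasure lam p θT, HasExpansion (h φ lam p θ) θT r F x := by
  obtain ⟨r, hr, hrN⟩ := Metric.isOpen_iff.1 hN.isOpen θT hθT
  choose F hF hFb using h3
  refine ⟨r, hr, hrN.trans hN.subset, fun x => ∑ i, ∑ j, ∑ k, |F i j k x|, ?_, ?_⟩
  · exact integrable_finsetSum _ fun i _ => integrable_finsetSum _ fun j _ =>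
      integrable_finsetSum _ fun k _ => (hF i j k).abs
  have hFb' := ae_all_iff.2 fun i => ae_all_iff.2 fun j => ae_all_iff.2 fun k => hFb i j k
  filter_upwards [hFb', ae_modelMeasure_isRegularPoint hmodel hθ hint (hN.subset hθT)] with x h3 hx
  have hle : ∀ i j k, F i j k x ≤ ∑ i, ∑ j, ∑ k, |F i j k x| := by
    intro i j k
    calc F i j k x ≤ |F i j k x| := le_abs_self _
      _ ≤ ∑ k, |F i j k x| := Finset.single_le_sum (f := fun k => |F i j k x|)
          (fun _ _ => abs_nonneg _) (Finset.mem_univ k)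
      _ ≤ ∑ j, ∑ k, |F i j k x| := Finset.single_le_sum (f := fun j => ∑ k, |F i j k x|)
          (fun _ _ => by positivity) (Finset.mem_univ j)
      _ ≤ _ := Finset.single_le_sum (f := fun i => ∑ j, ∑ k, |F i j k x|)
          (fun _ _ => by positivity) (Finset.mem_univ i)
  have hsub : ∀ α ∈ Metric.ball θT r, Metric.closedBall θT ‖α - θT‖ ⊆ N := fun α hα =>
    (Metric.closedBall_subset_ball (mem_ball_iff_norm.1 hα)).trans hrN
  have h1 : ∀ α ∈ N, ∀ k, LineDifferentiableAt ℝ (fun a => h φ lam p θ a x) α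
      (EuclideanSpace.single k 1) := fun α hα k =>
    (hasLineDerivAt_h hφ hmodel hθ hint hN hx hα k).lineDifferentiableAt
  have h2 : ∀ α ∈ N, ∀ j k, LineDifferentiableAt ℝ (pderiv k fun a => h φ lam p θ a x) α
      (EuclideanSpace.single j 1) := fun α hα j k =>
    (hasLineDerivAt_pderiv_h hφ hmodel hθ hint hN hx hα j k).lineDifferentiableAt
  refine ⟨fun α hα k => h1 α (hrN hα) k, fun α hα k => ?_, fun α hα => ?_⟩
  · exact abs_pderiv_sub_le (fun β hβ => h2 β (hsub α hα hβ))
      (fun β hβ i j k => ⟨(h3 i j k β (hsub α hα hβ)).1,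
        (h3 i j k β (hsub α hα hβ)).2.trans (hle i j k)⟩) (mem_closedBall_iff_norm.2 le_rfl) k
  · exact abs_sub_taylor_le (u := fun a => h φ lam p θ a x)
      (fun β hβ => h1 β (hsub α hα hβ)) (fun β hβ => h2 β (hsub α hα hβ))
      (fun β hβ i j k => ⟨(h3 i j k β (hsub α hα hβ)).1,
        (h3 i j k β (hsub α hα hβ)).2.trans (hle i j k)⟩)
      (fun j k => pderiv_pderiv_h_comm hφ hmodel hθ hint hN hx hθT j k)
      (mem_closedBall_iff_norm.2 le_rfl)

lemma ae_mul_pderiv_g (hθT : θT ∈ N) (i : Fin d) :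
    (fun x => p θT x * pderiv i (fun a => g φ p θ a x) θT) =ᵐ[lam]
      fun x => pderiv i (fun a => f φ p θ a x * p θ x) θT := by
  have hT := hN.subset hθT
  filter_upwards [ae_isRegularPoint hmodel hθ hint, hmodel.support_eq] with x hx hs
  rcases (hmodel.nonneg θT hT x).eq_or_lt with h | h
  · have h0 : p θ x = 0 := by
      refine le_antisymm (not_lt.1 fun hlt => ?_) (hmodel.nonneg θ hθ x)
      have := (hs θ hθ θT hT).1 hlt
      rw [← h] at this
      exact lt_irrefl _ this
    simp [← h, h0, pderiv, lineDeriv]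
  · exact (pderiv_f_mul hφ (hx θT hT h) (hN.mem_interior hθT) i).symm

/-- The scores `∂h(θ, θT)` are square integrable and centred. -/
lemma score_spec (hθT : θT ∈ N)
    (hsq : ∀ i, Integrable (fun x => pderiv i (fun a => h φ lam p θ a x) θT ^ 2)
      (modelMeasure lam p θT)) (i : Fin d) :
    MemLp (fun x => pderiv i (fun a => h φ lam p θ a x) θT) 2 (modelMeasure lam p θT) ∧
      ∫ x, pderiv i (fun a => h φ lam p θ a x) θT ∂modelMeasure lam p θT = 0 := by
  have hT := hN.subset hθT
  have := hmodel.isProbabilityMeasure θT hT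
  have hae : (fun x => pderiv i (fun a => h φ lam p θ a x) θT) =ᵐ[modelMeasure lam p θT]
      fun x => pderiv i (meanF φ lam p θ) θT - pderiv i (fun a => g φ p θ a x) θT := by
    filter_upwards [ae_modelMeasure_isRegularPoint hmodel hθ hint hT] with x hx
    exact pderiv_h hφ hmodel hθ hint hN hx hθT i
  have hmean := hasLineDerivAt_meanF hφ hmodel hθ hint hN hθT i
  have hg : Integrable (fun x => pderiv i (fun a => g φ p θ a x) θT) (modelMeasure lam p θT) := by
    rw [integrable_modelMeasure_iff hmodel hT]
    exact hmean.1.congr (ae_mul_pderiv_g hφ hmodel hθ hint hN hθT i).symm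
  constructor
  · refine (memLp_two_iff_integrable_sq ?_).2 (hsq i)
    exact ((integrable_const _).sub hg).aestronglyMeasurable.congr hae.symm
  · rw [integral_congr_ae hae, integral_sub (integrable_const _) hg, integral_const,
      integral_modelMeasure hmodel hT,
      integral_congr_ae (ae_mul_pderiv_g hφ hmodel hθ hint hN hθT i), pderiv, hmean.2.lineDeriv]
    simp

lemma matS_isSymm (hθT : θT ∈ N) : (matS φ lam p θ θT).IsSymm := by
  ext i j
  simp only [matS, Matrix.transpose_apply, Matrix.neg_apply, Matrix.of_apply]
  congr 1
  refine integral_congr_ae ?_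
  filter_upwards [ae_modelMeasure_isRegularPoint hmodel hθ hint (hN.subset hθT)] with x hx
  exact pderiv_pderiv_h_comm hφ hmodel hθ hint hN hx hθT j i

end Regularity

/-! ### The case `θ = θT` -/

section Fisher

lemma monotoneOn_deriv_re {φ : ℝ → ℝ≥0∞} (hφ : IsDivergenceFunction φ) :
    MonotoneOn (deriv (re φ)) (interior (dom φ)) :=
  hφ.strictConvex.convexOn.monotoneOn_deriv fun _ hy => (hasDerivAt_re hφ hy).differentiableAt

lemma exists_mul_le_deriv_re_sub {φ : ℝ → ℝ≥0∞} (hφ : IsDivergenceFunction φ)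
    (h : deriv (deriv (re φ)) 1 ≠ 0) :
    ∃ c > 0, ∀ y ∈ interior (dom φ), 1 ≤ y →
      c * (1 - 1 / y) ≤ deriv (re φ) y - deriv (re φ) 1 := by
  have hd := hasDerivAt_deriv_re hφ hφ.one_mem
  set k := deriv (deriv (re φ)) 1
  have hslope := (hasDerivAt_iff_tendsto_slope.1 hd).mono_left
    (nhdsWithin_mono _ (fun y (hy : y ∈ Set.Ioi (1 : ℝ)) => (ne_of_gt hy : y ≠ 1)))
  have hmem : ∀ᶠ y in 𝓝[>] (1 : ℝ), y ∈ interior (dom φ) :=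
    mem_nhdsWithin_of_mem_nhds (isOpen_interior.mem_nhds hφ.one_mem)
  have hk : 0 < k := by
    refine lt_of_le_of_ne (ge_of_tendsto hslope ?_) h.symm
    filter_upwards [hmem, self_mem_nhdsWithin] with y hy hy1
    rw [slope_def_field]
    have hy1' : (1 : ℝ) < y := hy1
    have := monotoneOn_deriv_re hφ hφ.one_mem hy hy1'.le
    exact div_nonneg (by linarith) (by linarith)
  have hev := (hslope.eventually_const_lt (half_lt_self hk)).and hmem
  obtain ⟨b, hb1, hb⟩ := (mem_nhdsGT_iff_exists_Ioo_subset.1 hev)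
  have hb1' : (1 : ℝ) < b := hb1
  set e := (b - 1) / 2 with he
  have he0 : 0 < e := by rw [he]; linarith
  have hloc : ∀ y, 1 ≤ y → y < b → k / 2 * (y - 1) ≤ deriv (re φ) y - deriv (re φ) 1 := by
    intro y hy hyb
    rcases hy.eq_or_lt with rfl | hy
    · simp
    · have := (hb ⟨hy, hyb⟩).1
      rw [slope_def_field, lt_div_iff₀ (by linarith)] at this
      exact this.le
  refine ⟨k / 2 * min 1 e, by positivity, fun y hy hy1 => ?_⟩
  have hy0 : 0 < y := by linarith
  have hinv : 0 ≤ 1 - 1 / y := by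
    rw [sub_nonneg, div_le_one hy0]; exact hy1
  by_cases hyb : y < b
  · refine le_trans ?_ (hloc y hy1 hyb)
    rw [mul_assoc]
    refine mul_le_mul_of_nonneg_left ?_ (by positivity)
    have h1 : 1 - 1 / y ≤ y - 1 := by
      rw [div_eq_inv_mul, mul_one]
      have : y * y⁻¹ = 1 := mul_inv_cancel₀ hy0.ne'
      nlinarith [sq_nonneg (y - 1), inv_pos.2 hy0]
    calc min 1 e * (1 - 1 / y) ≤ 1 * (1 - 1 / y) := by gcongr; exact min_le_left _ _
      _ ≤ y - 1 := by linarith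
  · have h2 : (1 + e) < b := by rw [he]; linarith
    have h3 := hloc (1 + e) (by linarith) h2
    have h4 := monotoneOn_deriv_re hφ (hb ⟨by linarith, h2⟩ : _ ∧ _).2 hy
      (by linarith [not_lt.1 hyb])
    have h5 : k / 2 * min 1 e * (1 - 1 / y) ≤ k / 2 * e * 1 := by
      gcongr
      · exact min_le_right _ _
      · linarith [one_div_pos.2 hy0]
    have h6 : k / 2 * (1 + e - 1) = k / 2 * e * 1 := by ring
    linarith

/-- Fatou's lemma for nonnegative real functions. -/
lemma integral_le_of_tendsto_of_nonneg {𝒳 : Type*} [MeasurableSpace 𝒳] {lam : Measure 𝒳}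
    {q : ℕ → 𝒳 → ℝ} {Q : 𝒳 → ℝ} {I : ℝ} (h0 : ∀ n, 0 ≤ᵐ[lam] q n)
    (hint : ∀ n, Integrable (q n) lam) (hI : ∀ n, ∫ x, q n x ∂lam ≤ I)
    (hlim : ∀ᵐ x ∂lam, Tendsto (fun n => q n x) atTop (𝓝 (Q x))) : ∫ x, Q x ∂lam ≤ I := by
  have hI0 : 0 ≤ I := (integral_nonneg_of_ae (h0 0)).trans (hI 0)
  have hQ0 : 0 ≤ᵐ[lam] Q := by
    filter_upwards [hlim, ae_all_iff.2 h0] with x hx hx0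
    exact ge_of_tendsto' hx hx0
  rw [integral_eq_lintegral_of_nonneg_ae hQ0
    (aestronglyMeasurable_of_tendsto_ae atTop (fun n => (hint n).aestronglyMeasurable) hlim)]
  refine ENNReal.toReal_le_of_le_ofReal hI0 ?_
  calc ∫⁻ x, ENNReal.ofReal (Q x) ∂lam
      = ∫⁻ x, liminf (fun n => ENNReal.ofReal (q n x)) atTop ∂lam := by
        refine lintegral_congr_ae ?_
        filter_upwards [hlim] with x hx
        exact ((ENNReal.continuous_ofReal.tendsto _).comp hx).liminf_eq.symm
    _ ≤ liminf (fun n => ∫⁻ x, ENNReal.ofReal (q n x) ∂lam) atTop :=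
        lintegral_liminf_le' fun n => (hint n).aemeasurable.ennreal_ofReal
    _ ≤ liminf (fun _ : ℕ => ENNReal.ofReal I) atTop := by
        refine liminf_le_liminf (Eventually.of_forall fun n => ?_)
        rw [← ofReal_integral_eq_lintegral_ofReal (hint n) (h0 n)]
        exact ENNReal.ofReal_le_ofReal (hI n)
    _ = _ := by simp

variable {𝒳 : Type*} [MeasurableSpace 𝒳] {d : ℕ} {φ : ℝ → ℝ≥0∞} {lam : Measure 𝒳}
  {Θ : Set (EuclideanSpace ℝ (Fin d))} {p : EuclideanSpace ℝ (Fin d) → 𝒳 → ℝ}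
  {θ : EuclideanSpace ℝ (Fin d)}
  {N : Set (EuclideanSpace ℝ (Fin d))} (hφ : IsDivergenceFunction φ)
  (hmodel : IsRegularModel lam Θ p) (hθ : θ ∈ Θ) (hint : DualIntegrable φ lam Θ p θ)
  (hN : IsDominatedOn φ lam Θ p θ N) (hθN : θ ∈ N)

lemma integrable_density {α : EuclideanSpace ℝ (Fin d)} (hmodel : IsRegularModel lam Θ p)
    (hα : α ∈ Θ) : Integrable (p α) lam ∧ ∫ x, p α x ∂lam = 1 := by
  have := hmodel.isProbabilityMeasure α hα
  constructor
  · simpa using (integrable_modelMeasure_iff hmodel hα).1 (integrable_const (1 : ℝ))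
  · simpa using (integral_modelMeasure hmodel hα fun _ => 1).symm

include hφ hmodel hθ hint hN hθN

/-- A density decreases at most linearly in the parameter, with an integrable rate. -/
lemma exists_density_sub_le (h : deriv (deriv (re φ)) 1 ≠ 0) (i : Fin d) :
    ∃ F : 𝒳 → ℝ, Integrable F lam ∧ ∃ ε > 0, ∀ᵐ x ∂lam, ∀ t : ℝ, |t| ≤ ε →
      θ + t • EuclideanSpace.single i 1 ∈ Θ ∧
      p θ x - p (θ + t • EuclideanSpace.single i 1) x ≤ F x * |t| := by
  obtain ⟨c, hc, hcy⟩ := exists_mul_le_deriv_re_sub hφ h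
  obtain ⟨F, hF, hFb⟩ := hN.first i
  set e : EuclideanSpace ℝ (Fin d) := EuclideanSpace.single i 1
  obtain ⟨r, hr, hrN⟩ := Metric.isOpen_iff.1 hN.isOpen θ hθN
  have hseg : ∀ t : ℝ, |t| ≤ r / 2 → θ + t • e ∈ N := by
    intro t ht
    refine hrN ?_
    simp only [Metric.mem_ball, dist_self_add_left, norm_smul, e]
    simp only [Real.norm_eq_abs, PiLp.norm_single, norm_one, mul_one]
    linarith
  refine ⟨fun x => c⁻¹ * F x, hF.const_mul _, r / 2, by positivity, ?_⟩
  filter_upwards [hFb, ae_isRegularPoint hmodel hθ hint, ae_contDiffOn_f_mul hφ hmodel hθ hint]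
    with x hFx hx hsm t ht
  have hα := hN.subset (hseg t ht)
  refine ⟨hα, ?_⟩
  have hF0 : 0 ≤ F x := (abs_nonneg _).trans (hFx θ hθN)
  by_cases hle : p θ x ≤ p (θ + t • e) x
  · have : 0 ≤ c⁻¹ * F x * |t| := by positivity
    linarith
  · push Not at hle
    have hpos : 0 < p θ x := (hmodel.nonneg _ hα x).trans_lt hle
    have hreg := hx θ hθ hpos
    have hpα := hreg.pos _ hα
    have hmv : ‖f φ p θ (θ + t • e) x * p θ x - f φ p θ (θ + (0 : ℝ) • e) x * p θ x‖ ≤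
        F x * ‖t - 0‖ := by
      refine Convex.norm_image_sub_le_of_norm_hasDerivWithin_le
        (f := fun s : ℝ => f φ p θ (θ + s • e) x * p θ x)
        (f' := fun s => pderiv i (fun a => f φ p θ a x * p θ x) (θ + s • e))
        (s := Metric.closedBall (0 : ℝ) |t|) (fun s hs => ?_) (fun s hs => ?_)
        (convex_closedBall _ _) (by simp) (by simp)
      · rw [mem_closedBall_zero_iff, Real.norm_eq_abs] at hs
        exact (hasDerivAt_line (u := fun a => f φ p θ a x * p θ x)
          (lineDifferentiableAt_of_contDiffOn (by norm_num) hsm isOpen_interior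
            (hN.mem_interior (hseg s (hs.trans ht))) e)).hasDerivWithinAt
      · rw [mem_closedBall_zero_iff, Real.norm_eq_abs] at hs
        exact hFx _ (hseg s (hs.trans ht))
    have h1 : 1 ≤ p θ x / p (θ + t • e) x := (one_le_div hpα).2 hle.le
    have h2 := hcy _ (hreg.ratio_mem _ hα) h1
    rw [zero_smul, add_zero, sub_zero, ← sub_mul, norm_mul, Real.norm_eq_abs, Real.norm_eq_abs,
      Real.norm_eq_abs, abs_of_pos hpos] at hmv
    simp only [f, div_self hpos.ne'] at hmv
    have h3 : c * (p θ x - p (θ + t • e) x) ≤ F x * |t| := by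
      calc c * (p θ x - p (θ + t • e) x)
          = c * (1 - 1 / (p θ x / p (θ + t • e) x)) * p θ x := by field_simp
        _ ≤ |deriv (re φ) (p θ x / p (θ + t • e) x) - deriv (re φ) 1| * p θ x := by
            gcongr
            exact h2.trans (le_abs_self _)
        _ ≤ _ := hmv
    rw [mul_assoc, le_inv_mul_iff₀ hc]
    exact h3

/-- The derivatives of the density integrate to zero. -/
lemma integral_pderiv_density (h : deriv (deriv (re φ)) 1 ≠ 0) (i : Fin d)
    (hpi : Integrable (fun x => pderiv i (fun a => p a x) θ) lam) :
    ∫ x, pderiv i (fun a => p a x) θ ∂lam = 0 := by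
  obtain ⟨F, hF, ε, hε, hFx⟩ := exists_density_sub_le hφ hmodel hθ hint hN hθN h i
  set e : EuclideanSpace ℝ (Fin d) := EuclideanSpace.single i 1
  have key : ∀ σ : ℝ, |σ| = 1 → σ * ∫ x, pderiv i (fun a => p a x) θ ∂lam ≤ 0 := by
    intro σ hσ
    have hσ0 : σ ≠ 0 := by rintro rfl; simp at hσ
    set s : ℕ → ℝ := fun n => ε / (n + 1) with hs
    have hs0 : ∀ n, 0 < s n := fun n => by positivity
    have hsε : ∀ n, |σ * s n| ≤ ε := fun n => by
      rw [abs_mul, hσ, one_mul, abs_of_pos (hs0 n), hs]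
      exact div_le_self hε.le (by linarith [(Nat.cast_nonneg n : (0 : ℝ) ≤ n)])
    have hslim : Tendsto s atTop (𝓝 0) :=
      tendsto_const_div_atTop_nhds_zero_nat ε |>.comp (tendsto_add_atTop_nat 1) |>.congr fun n => by
        simp [hs]
    have hlim0 : Tendsto (fun n => σ * s n) atTop (𝓝[≠] 0) := by
      refine tendsto_nhdsWithin_iff.2 ⟨by simpa using hslim.const_mul σ, ?_⟩
      exact Eventually.of_forall fun n => mul_ne_zero hσ0 (hs0 n).ne'
    have hmem : ∀ n, lam ≠ 0 → θ + (σ * s n) • e ∈ Θ := by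
      intro n hlam
      have : (ae lam).NeBot := ae_neBot.2 hlam
      obtain ⟨x, hx⟩ := hFx.exists
      exact (hx _ (hsε n)).1
    have hlam : lam ≠ 0 := by
      rintro rfl
      simpa using (integrable_density hmodel hθ).2
    have hfat := integral_le_of_tendsto_of_nonneg (lam := lam) (I := ∫ x, F x ∂lam)
      (q := fun n x => (s n)⁻¹ * (p (θ + (σ * s n) • e) x - p θ x) + F x)
      (Q := fun x => σ * pderiv i (fun a => p a x) θ + F x) (fun n => ?_) (fun n => ?_)
      (fun n => ?_) ?_
    · rw [integral_add (hpi.const_mul _) hF, integral_const_mul] at hfat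
      linarith
    · filter_upwards [hFx] with x hx
      have := (hx _ (hsε n)).2
      rw [abs_mul, hσ, one_mul, abs_of_pos (hs0 n)] at this
      have h1 : -F x ≤ (s n)⁻¹ * (p (θ + (σ * s n) • e) x - p θ x) := by
        rw [le_inv_mul_iff₀ (hs0 n)]
        linarith
      simp only [Pi.zero_apply]
      linarith
    · exact (((integrable_density hmodel (hmem n hlam)).1.sub
        (integrable_density hmodel hθ).1).const_mul _).add hF
    · have h1 := integrable_density hmodel (hmem n hlam)
      have h2 := integrable_density hmodel hθ
      have h3 : Integrable (fun x => p (θ + (σ * s n) • e) x - p θ x) lam := h1.1.sub h2.1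
      rw [integral_add (h3.const_mul _) hF, integral_const_mul,
        integral_sub h1.1 h2.1, h1.2, h2.2]
      simp
    · filter_upwards [hmodel.contDiff] with x hx
      have hd := (lineDifferentiableAt_of_contDiffOn (by norm_num) hx isOpen_interior
        (hN.mem_interior hθN) e).hasLineDerivAt
      have hd' := ((hasLineDerivAt_iff_tendsto_slope_zero.1 hd).comp hlim0).const_mul σ
      refine (hd'.congr fun n => ?_).add_const _
      simp only [Function.comp_apply, smul_eq_mul, mul_inv]
      rw [← mul_assoc, ← mul_assoc, mul_inv_cancel₀ hσ0, one_mul]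
  have h1 := key 1 (by simp)
  have h2 := key (-1) (by simp)
  linarith

/-- Relation between the Hessian of `g` and the Fisher information. -/
lemma ae_hess_self (i j : Fin d) :
    (fun x => p θ x * pderiv i (pderiv j fun a => g φ p θ a x) θ -
        pderiv i (pderiv j fun a => f φ p θ a x * p θ x) θ) =ᵐ[lam]
      fun x => deriv (deriv (re φ)) 1 *
        (pderiv i (fun a => p a x) θ * pderiv j (fun a => p a x) θ / p θ x) := by
  filter_upwards [ae_isRegularPoint hmodel hθ hint] with x hx
  rcases (hmodel.nonneg θ hθ x).eq_or_lt with h | h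
  · simp [← h, pderiv, lineDeriv]
  · rw [pderiv_pderiv_f_mul hφ (hx θ hθ h) (hN.mem_interior hθN),
      pderiv_g_self hφ (hx θ hθ h) (hN.mem_interior hθN)]
    ring

lemma matS_self (hhess : ∀ i j, Integrable
    (fun x => pderiv i (pderiv j fun a => h φ lam p θ a x) θ) (modelMeasure lam p θ)) :
    matS φ lam p θ θ = deriv (deriv (re φ)) 1 • fisher lam p θ := by
  have := hmodel.isProbabilityMeasure θ hθ
  ext i j
  simp only [matS, fisher, Matrix.neg_apply, Matrix.of_apply, Matrix.smul_apply, smul_eq_mul]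
  have hae : (fun x => pderiv i (pderiv j fun a => h φ lam p θ a x) θ) =ᵐ[modelMeasure lam p θ]
      fun x => pderiv i (pderiv j (meanF φ lam p θ)) θ -
        pderiv i (pderiv j fun a => g φ p θ a x) θ := by
    filter_upwards [ae_modelMeasure_isRegularPoint hmodel hθ hint hθ] with x hx
    exact pderiv_pderiv_h hφ hmodel hθ hint hN hx hθN i j
  have hg : Integrable (fun x => pderiv i (pderiv j fun a => g φ p θ a x) θ)
      (modelMeasure lam p θ) := by
    have := (integrable_const (pderiv i (pderiv j (meanF φ lam p θ)) θ)).sub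
      ((hhess i j).congr hae)
    refine this.congr (Eventually.of_forall fun x => ?_)
    simp
  have hmean := hasLineDerivAt_pderiv_meanF hφ hmodel hθ hint hN hθN i j
  rw [integral_congr_ae hae, integral_sub (integrable_const _) hg, integral_const,
    ← integral_const_mul, ← integral_congr_ae (ae_hess_self hφ hmodel hθ hint hN hθN i j),
    integral_sub ((integrable_modelMeasure_iff hmodel hθ).1 hg) hmean.1,
    ← integral_modelMeasure hmodel hθ, pderiv, hmean.2.lineDeriv]
  simp

/-- At `θ = θT` the score `∂h(θ, θ)` is proportional to the score of the model. -/
lemma ae_score_self (hk : deriv (deriv (re φ)) 1 ≠ 0) (i : Fin d) :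
    ∀ᵐ x ∂modelMeasure lam p θ, pderiv i (fun a => h φ lam p θ a x) θ =
      deriv (deriv (re φ)) 1 * (pderiv i (fun a => p a x) θ / p θ x) := by
  have hmean := hasLineDerivAt_meanF hφ hmodel hθ hint hN hθN i
  have hae : (fun x => pderiv i (fun a => f φ p θ a x * p θ x) θ) =ᵐ[lam]
      fun x => -deriv (deriv (re φ)) 1 * pderiv i (fun a => p a x) θ := by
    filter_upwards [ae_isRegularPoint hmodel hθ hint, hmodel.support_eq] with x hx hs
    rcases (hmodel.nonneg θ hθ x).eq_or_lt with h | h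
    · have h0 : pderiv i (fun a => p a x) θ = 0 := by
        rw [pderiv_congr_of_eqOn (v := fun _ => 0) hN.isOpen (fun β hβ => ?_) hθN]
        · simp [pderiv, lineDeriv]
        · refine le_antisymm (not_lt.1 fun hlt => ?_) (hmodel.nonneg β (hN.subset hβ) x)
          have := (hs β (hN.subset hβ) θ hθ).1 hlt
          rw [← h] at this
          exact lt_irrefl _ this
      rw [h0]
      simp [← h, pderiv, lineDeriv]
    · rw [pderiv_f_mul hφ (hx θ hθ h) (hN.mem_interior hθN),
        pderiv_g_self hφ (hx θ hθ h) (hN.mem_interior hθN)]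
      field_simp
  have hpi : Integrable (fun x => pderiv i (fun a => p a x) θ) lam := by
    refine ((hmean.1.congr hae).const_mul (-deriv (deriv (re φ)) 1)⁻¹).congr
      (Eventually.of_forall fun x => ?_)
    simp only
    rw [inv_mul_cancel_left₀ (neg_ne_zero.2 hk)]
  have h0 : pderiv i (meanF φ lam p θ) θ = 0 := by
    rw [pderiv, hmean.2.lineDeriv, integral_congr_ae hae, integral_const_mul,
      integral_pderiv_density hφ hmodel hθ hint hN hθN hk i hpi, mul_zero]
  filter_upwards [ae_modelMeasure_isRegularPoint hmodel hθ hint hθ] with x hx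
  rw [pderiv_h hφ hmodel hθ hint hN hx hθN, h0, pderiv_g_self hφ hx (hN.mem_interior hθN)]
  ring

lemma fisher_spec (hk : deriv (deriv (re φ)) 1 ≠ 0)
    (hscore : ∀ i, MemLp (fun x => pderiv i (fun a => h φ lam p θ a x) θ) 2
      (modelMeasure lam p θ)) (i j : Fin d) :
    Integrable (fun x => pderiv i (fun a => p a x) θ * pderiv j (fun a => p a x) θ / p θ x) lam ∧
      matM φ lam p θ θ i j = deriv (deriv (re φ)) 1 ^ 2 * fisher lam p θ i j := by
  have hae : (fun x => pderiv i (fun a => h φ lam p θ a x) θ *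
      pderiv j (fun a => h φ lam p θ a x) θ) =ᵐ[modelMeasure lam p θ] fun x =>
      deriv (deriv (re φ)) 1 ^ 2 * (pderiv i (fun a => p a x) θ / p θ x *
        (pderiv j (fun a => p a x) θ / p θ x)) := by
    filter_upwards [ae_score_self hφ hmodel hθ hint hN hθN hk i,
      ae_score_self hφ hmodel hθ hint hN hθN hk j] with x h1 h2
    rw [h1, h2]
    ring
  have heq : ∀ x, p θ x * (pderiv i (fun a => p a x) θ / p θ x *
      (pderiv j (fun a => p a x) θ / p θ x)) =
      pderiv i (fun a => p a x) θ * pderiv j (fun a => p a x) θ / p θ x := by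
    intro x
    by_cases h : p θ x = 0
    · simp [h]
    · field_simp
  constructor
  · have h1 : Integrable (fun x => pderiv i (fun a => h φ lam p θ a x) θ *
        pderiv j (fun a => h φ lam p θ a x) θ) (modelMeasure lam p θ) :=
      (hscore i).integrable_mul (hscore j)
    have h2 := (integrable_modelMeasure_iff hmodel hθ).1
      (((h1.congr hae).const_mul (deriv (deriv (re φ)) 1 ^ 2)⁻¹))
    refine h2.congr (Eventually.of_forall fun x => ?_)
    simp only
    rw [inv_mul_cancel_left₀ (pow_ne_zero 2 hk), heq]
  · simp only [matM, fisher, Matrix.of_apply]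
    rw [integral_congr_ae hae, integral_const_mul, integral_modelMeasure hmodel hθ]
    simp_rw [heq]

end Fisher

/-! ### The dual representation of the divergence -/

section Dual

variable {𝒳 : Type*} [MeasurableSpace 𝒳] {d : ℕ} {φ : ℝ → ℝ≥0∞} {lam : Measure 𝒳}
  {Θ : Set (EuclideanSpace ℝ (Fin d))} {p : EuclideanSpace ℝ (Fin d) → 𝒳 → ℝ}
  {θ α : EuclideanSpace ℝ (Fin d)}

lemma measurable_h (hφ : IsDivergenceFunction φ) (hmodel : IsRegularModel lam Θ p) (hθ : θ ∈ Θ)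
    (hα : α ∈ Θ) : Measurable (h φ lam p θ α) := by
  have hr : Measurable fun x => p θ x / p α x :=
    (hmodel.measurable θ hθ).div (hmodel.measurable α hα)
  exact measurable_const.sub
    ((hr.mul ((measurable_deriv (re φ)).comp hr)).sub ((measurable_re hφ).comp hr))

lemma modelMeasure_eq_withDensity (hmodel : IsRegularModel lam Θ p) (hθ : θ ∈ Θ) (hα : α ∈ Θ) :
    modelMeasure lam p θ =
      (modelMeasure lam p α).withDensity fun x => ENNReal.ofReal (p θ x / p α x) := by
  have hr : Measurable fun x => p θ x / p α x :=
    (hmodel.measurable θ hθ).div (hmodel.measurable α hα)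
  rw [modelMeasure, modelMeasure, ← withDensity_mul _ (hmodel.measurable α hα).ennreal_ofReal
    hr.ennreal_ofReal]
  refine withDensity_congr_ae ?_
  filter_upwards [hmodel.support_eq] with x hx
  simp only [Pi.mul_apply]
  rw [← ENNReal.ofReal_mul (hmodel.nonneg α hα x)]
  rcases (hmodel.nonneg α hα x).eq_or_lt with h0 | h0
  · have : p θ x = 0 := le_antisymm (not_lt.1 fun hlt => by
      have := (hx θ hθ α hα).1 hlt
      rw [← h0] at this
      exact lt_irrefl _ this) (hmodel.nonneg θ hθ x)
    simp [← h0, this]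
  · rw [mul_div_cancel₀ _ h0.ne']

/-- The divergence is finite and equal to the mean of `h(θ, α)` with respect to `P_α`. -/
lemma divergence_eq (hmodel : IsRegularModel lam Θ p) (hθ : θ ∈ Θ)
    (hint : DualIntegrable φ lam Θ p θ) (hα : α ∈ Θ)
    (hh : Integrable (h φ lam p θ α) (modelMeasure lam p α)) :
    0 ≤ ∫ x, h φ lam p θ α x ∂modelMeasure lam p α ∧
    divergence φ (modelMeasure lam p θ) (modelMeasure lam p α) =
      ENNReal.ofReal (∫ x, h φ lam p θ α x ∂modelMeasure lam p α) := by
  have := hmodel.isProbabilityMeasure α hα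
  have hr : Measurable fun x => p θ x / p α x :=
    (hmodel.measurable θ hθ).div (hmodel.measurable α hα)
  have heq := modelMeasure_eq_withDensity hmodel hθ hα
  have hac : modelMeasure lam p θ ≪ modelMeasure lam p α := by
    rw [heq]
    exact withDensity_absolutelyContinuous _ _
  have hrn : (modelMeasure lam p θ).rnDeriv (modelMeasure lam p α) =ᵐ[modelMeasure lam p α]
      fun x => ENNReal.ofReal (p θ x / p α x) := by
    nth_rewrite 1 [heq]
    exact Measure.rnDeriv_withDensity _ hr.ennreal_ofReal
  have hreg := ae_modelMeasure_isRegularPoint hmodel hθ hint hα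
  have hf : (fun x => p α x * (p θ x / p α x * f φ p θ α x)) =ᵐ[lam]
      fun x => p θ x * f φ p θ α x := by
    filter_upwards [hmodel.support_eq] with x hx
    rcases (hmodel.nonneg α hα x).eq_or_lt with h0 | h0
    · have : p θ x = 0 := le_antisymm (not_lt.1 fun hlt => by
        have := (hx θ hθ α hα).1 hlt
        rw [← h0] at this
        exact lt_irrefl _ this) (hmodel.nonneg θ hθ x)
      simp [this]
    · field_simp
  have hrf : Integrable (fun x => p θ x / p α x * f φ p θ α x) (modelMeasure lam p α) := by
    rw [integrable_modelMeasure_iff hmodel hα]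
    exact ((integrable_modelMeasure_iff hmodel hθ).1 (hint.2 α hα)).congr hf.symm
  have hrf' : ∫ x, p θ x / p α x * f φ p θ α x ∂modelMeasure lam p α = meanF φ lam p θ α := by
    rw [integral_modelMeasure hmodel hα, integral_congr_ae hf, meanF,
      integral_modelMeasure hmodel hθ]
  have hre : ∀ x, re φ (p θ x / p α x) =
      h φ lam p θ α x - meanF φ lam p θ α + p θ x / p α x * f φ p θ α x := by
    intro x
    rw [h_eq]
    simp only [g, f]
    ring
  have hh' : Integrable (fun x => h φ lam p θ α x - meanF φ lam p θ α) (modelMeasure lam p α) :=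
    hh.sub (integrable_const _)
  have hrei : Integrable (fun x => re φ (p θ x / p α x)) (modelMeasure lam p α) := by
    simp_rw [hre]
    exact hh'.add hrf
  have hint' : ∫ x, re φ (p θ x / p α x) ∂modelMeasure lam p α =
      ∫ x, h φ lam p θ α x ∂modelMeasure lam p α := by
    simp_rw [hre]
    rw [integral_add hh' hrf, integral_sub hh (integrable_const _), hrf']
    simp
  rw [← hint']
  refine ⟨integral_nonneg fun x => ENNReal.toReal_nonneg, ?_⟩
  rw [divergence, if_pos hac, ofReal_integral_eq_lintegral_ofReal hrei
    (Eventually.of_forall fun x => ENNReal.toReal_nonneg)]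
  refine lintegral_congr_ae ?_
  filter_upwards [hrn, hreg] with x hx hxr
  rw [hx, ENNReal.toReal_ofReal (div_nonneg (hmodel.nonneg θ hθ x) (hmodel.nonneg α hα x)), re,
    ENNReal.ofReal_toReal]
  have : p θ x / p α x ∈ dom φ := interior_subset (hxr.ratio_mem α hα)
  exact ne_of_lt this

lemma ae_h_self (hφ : IsDivergenceFunction φ) (hmodel : IsRegularModel lam Θ p) (hθ : θ ∈ Θ) :
    ∀ᵐ x ∂modelMeasure lam p θ, h φ lam p θ θ x = 0 := by
  have := hmodel.isProbabilityMeasure θ hθ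
  have hpos : ∀ᵐ x ∂modelMeasure lam p θ, 0 < p θ x :=
    (ae_modelMeasure_iff hmodel hθ).2 (Eventually.of_forall fun x hx => hx)
  have hmean : meanF φ lam p θ θ = deriv (re φ) 1 := by
    rw [meanF, integral_congr_ae (g := fun _ => deriv (re φ) 1)]
    · simp
    · filter_upwards [hpos] with x hx
      simp [f, div_self hx.ne']
  filter_upwards [hpos] with x hx
  rw [h_eq, hmean]
  simp [g, div_self hx.ne', re_one hφ]

end Dual

lemma divEstimate_eq {𝒳 Ω : Type*} [MeasurableSpace 𝒳] {d : ℕ} {φ : ℝ → ℝ≥0∞} {lam : Measure 𝒳}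
    {Θ : Set (EuclideanSpace ℝ (Fin d))} {p : EuclideanSpace ℝ (Fin d) → 𝒳 → ℝ}
    {X : ℕ → Ω → 𝒳} {θ a : EuclideanSpace ℝ (Fin d)} {n : ℕ} {ω : Ω}
    (ha : IsDualEstimate φ lam Θ p X θ n ω a) :
    divEstimate φ lam Θ p X θ n ω = empMean X n (h φ lam p θ a) ω := by
  refine IsGreatest.csSup_eq ⟨Set.mem_image_of_mem _ ha.1, ?_⟩
  rintro _ ⟨b, hb, rfl⟩
  exact ha.2 hb

lemma tendstoInDistribution_id {Ω Ω' E : Type*} [MeasurableSpace Ω] [MeasurableSpace Ω']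
    [MeasurableSpace E] [TopologicalSpace E] [OpensMeasurableSpace E] {μ : Measure Ω}
    [IsProbabilityMeasure μ] {ν : Measure Ω'} [IsProbabilityMeasure ν] {κ : Measure E}
    [IsProbabilityMeasure κ] {Y : ℕ → Ω → E} {Z : Ω' → E}
    (hY : TendstoInDistribution Y atTop Z (fun _ => μ) ν) (hZ : ν.map Z = κ) :
    TendstoInDistribution Y atTop id (fun _ => μ) κ := by
  refine ⟨hY.forall_aemeasurable, aemeasurable_id, ?_⟩
  have : (⟨κ.map id, Measure.isProbabilityMeasure_map aemeasurable_id⟩ : ProbabilityMeasure E) =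
      ⟨ν.map Z, Measure.isProbabilityMeasure_map hY.aemeasurable_limit⟩ :=
    Subtype.ext (by simp [hZ])
  rw [this]
  exact hY.tendsto

lemma tendstoInMeasure_inv_sqrt {Ω : Type*} [MeasurableSpace Ω] {μ : Measure Ω}
    [IsProbabilityMeasure μ] :
    TendstoInMeasure μ (fun (n : ℕ) (_ : Ω) => (√(n : ℝ))⁻¹) atTop fun _ => 0 :=
  tendstoInMeasure_of_tendsto_ae (fun _ => aestronglyMeasurable_const)
    (Eventually.of_forall fun _ => tendsto_inv_atTop_zero.comp
      (Real.tendsto_sqrt_atTop.comp tendsto_natCast_atTop_atTop))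

end DualDivergence

end

open DualDivergence in
theorem mainTheorem3 {𝒳 Ω : Type*} [MeasurableSpace 𝒳] [MeasurableSpace Ω] {d : ℕ}
    (φ : ℝ → ℝ≥0∞) (hφ : DualDivergence.IsDivergenceFunction φ)
    (lam : Measure 𝒳) [SigmaFinite lam]
    (Θ : Set (EuclideanSpace ℝ (Fin d))) (p : EuclideanSpace ℝ (Fin d) → 𝒳 → ℝ)
    (hmodel : DualDivergence.IsRegularModel lam Θ p)
    (θ θT : EuclideanSpace ℝ (Fin d)) (hθ : θ ∈ Θ) (hθT : θT ∈ interior Θ)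
    (hint : DualDivergence.DualIntegrable φ lam Θ p θ)
    (μ : Measure Ω) [IsProbabilityMeasure μ] (X : ℕ → Ω → 𝒳)
    (hlaw : ∀ i, HasLaw (X i) (DualDivergence.modelMeasure lam p θT) μ)
    (hindep : iIndepFun X μ)
    (αhat : ℕ → Ω → EuclideanSpace ℝ (Fin d))
    (hαmeas : ∀ n, AEMeasurable (αhat n) μ)
    (hDmeas : ∀ n, AEMeasurable (DualDivergence.divEstimate φ lam Θ p X θ n) μ)
    (hA0 : DualDivergence.AssumptionA0 φ lam Θ p μ X θ θT αhat)
    (hA1 : DualDivergence.AssumptionA1 φ lam Θ p θ θT)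
    (hA2 : DualDivergence.AssumptionA2 φ lam p θ θT) :
    (TendstoInDistribution (fun (n : ℕ) ω => √(n : ℝ) • (αhat n ω - θT)) atTop id (fun _ => μ)
        (multivariateGaussian 0 (DualDivergence.matV φ lam p θ θT)) ∧
      (DualDivergence.matV φ lam p θ θT).PosSemidef ∧
      (θ = θT →
        (∀ i j, Integrable (fun x => DualDivergence.pderiv i (fun a => p a x) θT *
          DualDivergence.pderiv j (fun a => p a x) θT / p θT x) lam) ∧
        IsUnit (DualDivergence.fisher lam p θT).det ∧
        DualDivergence.matV φ lam p θ θT = (DualDivergence.fisher lam p θT)⁻¹)) ∧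
    (θ = θT →
      TendstoInDistribution
        (fun (n : ℕ) ω => 2 * (n : ℝ) / deriv (deriv (DualDivergence.re φ)) 1 *
          DualDivergence.divEstimate φ lam Θ p X θ n ω)
        atTop id (fun _ => μ) (DualDivergence.chiSquare d)) ∧
    (DualDivergence.AssumptionA3 φ lam p θ θT → θ ≠ θT →
      DualDivergence.divergence φ (DualDivergence.modelMeasure lam p θ)
        (DualDivergence.modelMeasure lam p θT) ≠ ⊤ ∧
      0 ≤ DualDivergence.sigmaSq φ lam p θ θT ∧
      TendstoInDistribution
        (fun (n : ℕ) ω => √(n : ℝ) * (DualDivergence.divEstimate φ lam Θ p X θ n ω -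
          (DualDivergence.divergence φ (DualDivergence.modelMeasure lam p θ)
            (DualDivergence.modelMeasure lam p θT)).toReal))
        atTop id (fun _ => μ) (gaussianReal 0 (DualDivergence.sigmaSq φ lam p θ θT).toNNReal)) := by
  obtain ⟨N, hNo, hθN, hNΘ, hb1, hb2, hb3⟩ := hA1
  have hN : IsDominatedOn φ lam Θ p θ N := ⟨hNo, hNΘ, hb1, hb2⟩
  have hT : θT ∈ Θ := interior_subset hθT
  have hP := hmodel.isProbabilityMeasure θT hT
  set S := matS φ lam p θ θT with hSdef
  set M := matM φ lam p θ θT with hMdef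
  have hSsymm : S.IsSymm := matS_isSymm hφ hmodel hθ hint hN hθN
  have hdet : IsUnit S.det := hA2.nonsingular
  have hscore := score_spec hφ hmodel hθ hint hN hθN hA2.integrable_sq
  obtain ⟨r, hr, hrΘ, F, hF, hexp⟩ := exists_hasExpansion hφ hmodel hθ hint hN hθN hb3
  obtain ⟨B, hB, hBω⟩ := exists_expansion_empMean hr hexp hlaw hrΘ hA0.exist hA0.consistent
  set ψ : ℕ → Ω → EuclideanSpace ℝ (Fin d) := fun n ω => WithLp.toLp 2 fun i =>
    empMean X n (fun x => pderiv i (fun a => h φ lam p θ a x) θT) ω with hψdef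
  set H : Fin d → Fin d → ℕ → Ω → ℝ := fun j k n =>
    empMean X n (fun x => pderiv j (pderiv k fun a => h φ lam p θ a x) θT) with hHdef
  set δ : ℕ → Ω → EuclideanSpace ℝ (Fin d) := fun n ω => αhat n ω - θT with hδdef
  set R : ℕ → Ω → ℝ := fun n ω => remainder S (fun j k => H j k n ω) (empMean X n F ω) (δ n ω)
    with hRdef
  obtain ⟨hMpsd, hclt⟩ := tendstoInDistribution_empMean_vector hlaw hindep
    (fun i => (hscore i).1) (fun i => (hscore i).2) (M := M) fun i j => rfl
  have hδm : ∀ n, AEMeasurable (δ n) μ := fun n => (hαmeas n).sub_const _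
  have hFm : ∀ n, AEMeasurable (empMean X n F) μ := aemeasurable_empMean hlaw hF.aemeasurable
  have hRm : ∀ n, AEMeasurable (R n) μ := aemeasurable_remainder
    (fun j k => aemeasurable_empMean hlaw (hA2.integrable_hess j k).aemeasurable) hFm hδm
  have hR : TendstoInMeasure μ R atTop fun _ => 0 :=
    tendstoInMeasure_remainder hFm hδm (fun j k => by
      have := tendstoInMeasure_empMean hlaw hindep (hA2.integrable_hess j k)
      simpa [hSdef, matS] using this)
      (tendstoInMeasure_empMean hlaw hindep hF) (tendstoInMeasure_sub_const hA0.consistent)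
  have hR0 : ∀ n ω, 0 ≤ R n ω := fun n ω => remainder_nonneg _ _ _ _
  have hY := tendstoInDistribution_sqrt_smul (δ := δ) (ψ := ψ) hdet hδm hRm hR hR0 hclt hB
    fun n ω hω => norm_sub_le_remainder hSsymm (hBω n ω hω).2.1
  have hSinvT : (S⁻¹)ᵀ = S⁻¹ := by rw [Matrix.transpose_nonsing_inv, hSsymm.eq]
  have hVpsd : (matV φ lam p θ θT).PosSemidef := by
    have := hMpsd.mul_mul_conjTranspose_same S⁻¹
    rwa [Matrix.conjTranspose_eq_transpose_of_trivial, hSinvT] at this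
  have hYid := tendstoInDistribution_id hY
    ((map_toEuclideanCLM_multivariateGaussian hMpsd S⁻¹).trans
      (by rw [hSinvT]; rfl : _ = multivariateGaussian 0 (matV φ lam p θ θT)))
  set D := divEstimate φ lam Θ p X θ with hDdef
  have hval := tendstoInMeasure_value (S := S) (D := D)
    (a := fun n => empMean X n (h φ lam p θ θT)) hRm hR hYid hB fun n ω hω => by
      have hω := hBω n ω hω
      rw [hDdef, divEstimate_eq hω.1]
      exact abs_value_sub_le_remainder (ψ := ψ n ω) hω.2.1 hω.2.2
  have hself : θ = θT → M = deriv (deriv (re φ)) 1 • S ∧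
      S = deriv (deriv (re φ)) 1 • fisher lam p θT ∧
      (∀ _ : Fin d, deriv (deriv (re φ)) 1 ≠ 0) ∧
      (∀ i j, Integrable (fun x => pderiv i (fun a => p a x) θT *
        pderiv j (fun a => p a x) θT / p θT x) lam) ∧
      matV φ lam p θ θT * fisher lam p θT = 1 := by
    rintro rfl
    have hS := matS_self hφ hmodel hθ hint hN hθN hA2.integrable_hess
    have hk : ∀ _ : Fin d, deriv (deriv (re φ)) 1 ≠ 0 := by
      intro i hk0
      have : Nonempty (Fin d) := ⟨i⟩
      rw [hSdef, hS, hk0, zero_smul, Matrix.det_zero] at hdet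
      exact not_isUnit_zero hdet
    have hfi := fun i => fisher_spec hφ hmodel hθ hint hN hθN (hk i) (fun i => (hscore i).1) i
    have hM : M = deriv (deriv (re φ)) 1 • S := by
      ext i j
      rw [hMdef, (hfi i j).2, hSdef, hS]
      simp only [Matrix.smul_apply, smul_eq_mul]
      ring
    refine ⟨hM, hS, hk, fun i j => (hfi i j).1, ?_⟩
    have hV : matV φ lam p θ θ = S⁻¹ * M * S⁻¹ := rfl
    rw [hV, hM, Matrix.mul_smul, Matrix.nonsing_inv_mul _ hdet, Matrix.smul_mul, one_mul,
      Matrix.smul_mul, ← Matrix.mul_smul, ← hS]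
    exact Matrix.nonsing_inv_mul _ hdet
  refine ⟨⟨hYid, hVpsd, fun he => ?_⟩, fun he => ?_, fun hA3 _ => ?_⟩
  · obtain ⟨-, -, -, hI, hVI⟩ := hself he
    exact ⟨hI, Matrix.isUnit_det_of_left_inverse hVI, (Matrix.inv_eq_left_inv hVI).symm⟩
  · obtain ⟨-, hSI, hk, -, hVI⟩ := hself he
    set k := deriv (deriv (re φ)) 1 with hkdef
    have hq : Continuous fun z : EuclideanSpace ℝ (Fin d) =>
      ∑ k, ∑ j, fisher lam p θT j k * z j * z k := by fun_prop
    refine tendstoInDistribution_id (tendstoInDistribution_of_quadratic hYid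
      (fun n => (hDmeas n).const_mul _) hq ?_) (map_quadratic_multivariateGaussian hVpsd hVI)
    refine (tendstoInMeasure_zero_const_mul hval (2 / k)).congr_left fun n => ?_
    subst he
    filter_upwards [ae_forall_comp_of_hasLaw hlaw (ae_h_self hφ hmodel hθ)] with ω hω
    have ha : empMean X n (h φ lam p θ θ) ω = 0 := by simp [empMean, hω]
    have hI : ∀ i j, fisher lam p θ i j = 1 / k * S i j := by
      intro i j
      rw [hSI, Matrix.smul_apply, smul_eq_mul, one_div, inv_mul_cancel_left₀ (hk i)]
    simp only [ha, hI, sub_zero, mul_assoc, ← Finset.mul_sum]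
    ring
  · have hhm := measurable_h hφ hmodel hθ hT (θ := θ)
    have hL : MemLp (h φ lam p θ θT) 2 (modelMeasure lam p θT) :=
      (memLp_two_iff_integrable_sq hhm.aestronglyMeasurable).2 hA3
    have hh := hL.integrable one_le_two
    obtain ⟨hnn, hdiv⟩ := divergence_eq hmodel hθ hint hT hh
    have hvar : Var[h φ lam p θ θT; modelMeasure lam p θT] = sigmaSq φ lam p θ θT := by
      rw [variance_eq_sub hL]; rfl
    refine ⟨by rw [hdiv]; exact ENNReal.ofReal_ne_top, hvar ▸ variance_nonneg _ _, ?_⟩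
    rw [hdiv, ENNReal.toReal_ofReal hnn]
    have hcl := tendstoInDistribution_empMean hlaw hindep hL
      (v := (sigmaSq φ lam p θ θT).toNNReal) (by rw [hvar])
    refine tendstoInDistribution_of_tendstoInMeasure_sub _ _ hcl ?_
      fun n => ((hDmeas n).sub_const _).const_mul _
    have hWm : ∀ n : ℕ, AEMeasurable
        (fun ω => (n : ℝ) * (D n ω - empMean X n (h φ lam p θ θT) ω)) μ := fun n =>
      ((hDmeas n).sub (aemeasurable_empMean hlaw hhm.aemeasurable n)).const_mul _
    have hW := tendstoInDistribution_of_quadratic hYid hWm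
      (q := fun z => 2⁻¹ * ∑ k, ∑ j, S j k * z j * z k) (by fun_prop) hval
    refine (tendstoInMeasure_zero_mul hW tendstoInMeasure_inv_sqrt (fun n => aemeasurable_const)
      continuous_id).congr_left fun n => Eventually.of_forall fun ω => ?_
    simp only [id, Pi.sub_apply]
    rcases Nat.eq_zero_or_pos n with rfl | hn
    · simp
    · have : (0 : ℝ) < n := by exact_mod_cast hn
      have hs : √(n : ℝ) ≠ 0 := (Real.sqrt_pos.2 this).ne'
      have hs2 : √(n : ℝ) * √(n : ℝ) = n := Real.mul_self_sqrt this.le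
      have : (√(n : ℝ))⁻¹ * n = √(n : ℝ) := by
        nth_rewrite 2 [← hs2]
        rw [inv_mul_cancel_left₀ hs]
      rw [← mul_assoc, this]
      ring
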